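/- Consider the wave equation $u_{tt}=u_{xx}$ on $(0,\pi)\times(0,\infty)$ with Dirichlet conditions $u(0,t)=u(\pi,t)=0$ and initial data $u(\cdot,0)=u_0\in H^1_0(0,\pi)$, $u_t(\cdot,0)=u_1\in L^2(0,\pi)$, with energy $E_0=\frac12\int_0^\pi(|u_0'|^2+|u_1|^2)\,dx$. The boundary traces $u_x(0,\cdot),u_x(\pi,\cdot)\in L^2(0,T)$ of a weak solution $u$ are given by extending by continuity, from $(H^2\cap H^1_0)\times H^1_0$ to $H^1_0\times L^2$, the map sending the initial data to the Sobolev trace of $u_x$. For $T_0\in(0,2\pi)$ let $I_k=(kT_0,(k+1)T_0)$, $k=0,1,2,\dots$, and let $\lambda_k=0$ for even $k$, $\lambda_k=\pi$ for odd $k$. The system is called observable in time $T>0$ (at rate $T_0$) if there are $n\in\mathbb N$ and $c>0$ such that $$\sum_{k=0}^{n}\int_{I_k\cap(0,T)}|u_x(\lambda_k,t)|^2\,dt\ \ge\ c\,E_0$$ for all $(u_0,u_1)\in H^1_0(0,\pi)\times L^2(0,\pi)$, where $u$ is the weak solution with these data. If the system is observable in time $T$ but in no time $T'<T$, then $T_{opt}(T_0):=T$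 is called the optimal control time. Proposition. Let $k\ge 2$ be an even integer and $B_k=\left(\frac{\pi}{k+1},\frac{\pi}{k+1/2}\right)$. Then $T_{opt}(T_0)$ exists for every $T_0\in B_k$, and the set of discontinuities of the map $T_{opt}(\cdot)$ on $B_k$ is exactly $\{\xi_m : m=1,2,3,\dots\}$, where $$\xi_m=\frac{\pi}{k+\frac{m+1}{m+2}}.$$ Furthermore, for each integer $m\ge 1$, $$\lim_{t\nearrow\xi_m}T_{opt}(t)=\pi(m+3)+k\,\xi_m,\qquad \lim_{t\searrow\xi_m}T_{opt}(t)=\pi(m+2)+k\,\xi_m;$$ in particular $\lim_{t\nearrow\xi_m}T_{opt}(t)-\lim_{t\searrow\xi_m}T_{opt}(t)=\pi$. -/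

import Mathlib

open MeasureTheory Filter Set Topology

namespace AlternatingWave

/-- Lebesgue measure on the interval `Ω = (0, π)`. -/
noncomputable abbrev mu : Measure ℝ := volume.restrict (Ioo 0 Real.pi)

/-- The real Hilbert space `L²(0, π)`. -/
noncomputable abbrev L2 : Type := Lp ℝ 2 mu

/-- Test functions: `C^∞` functions with compact support contained in `(0, π)`. -/
def IsTest (φ : ℝ → ℝ) : Prop :=
  ContDiff ℝ ((⊤ : ℕ∞) : WithTop ℕ∞) φ ∧ HasCompactSupport φ ∧ tsupport φ ⊆ Ioo 0 Real.pi

/-- `H¹₀(0, π)`, the closure of the test functions in the `H¹` norm. An element `w` is stored as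
the pair of the function `w.1` and its weak derivative `w.2`, both in `L²(0, π)`. -/
def H10 : Set (L2 × L2) :=
  closure {w | ∃ φ : ℝ → ℝ, IsTest φ ∧ w.1 =ᵐ[mu] φ ∧ w.2 =ᵐ[mu] deriv φ}

/-- `q ∈ L²(0, π)` is the weak derivative of `p ∈ L²(0, π)` on `(0, π)`; so `p ∈ H¹(0, π)`. -/
def HasWeakDeriv (p q : L2) : Prop :=
  ∀ φ : ℝ → ℝ, IsTest φ →
    ∫ x in Ioo 0 Real.pi, p x * deriv φ x = - ∫ x in Ioo 0 Real.pi, q x * φ x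

/-- Weak solutions `u ∈ C([0,∞); H¹₀) ∩ C¹([0,∞); L²)` of `u_tt = u_xx` on `(0, π)` with Dirichlet
boundary conditions and initial data `u₀ ∈ H¹₀`, `u₁ ∈ L²`. Here `u t` is the pair
`(u(·,t), u_x(·,t))` and `ut t` is `u_t(·,t)`. -/
structure IsWeakSolution (u : ℝ → L2 × L2) (ut : ℝ → L2) (u₀ : L2 × L2) (u₁ : L2) : Prop where
  mem : ∀ t, 0 ≤ t → u t ∈ H10
  cont : ContinuousOn u (Ici 0)
  deriv_u : ∀ t, 0 ≤ t → HasDerivWithinAt (fun s => (u s).1) (ut t) (Ici 0) t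
  cont_ut : ContinuousOn ut (Ici 0)
  weak_eq : ∀ w ∈ H10, ∀ t, 0 ≤ t →
    HasDerivWithinAt (fun s => inner ℝ (ut s) w.1) (- inner ℝ (u t).2 w.2) (Ici 0) t
  init_u : u 0 = u₀
  init_ut : ut 0 = u₁

/-- Strong solutions `u ∈ C([0,∞); H² ∩ H¹₀) ∩ C²([0,∞); L²)` of the same problem with initial data
`u₀ ∈ H² ∩ H¹₀`, `u₁ ∈ H¹₀`. Here `u t = (u(·,t), u_x(·,t))`, `ut t = u_t(·,t)`,
`uxx t = u_xx(·,t)`; the equation says that the time derivative of `ut` is `uxx`. -/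
structure IsStrongSolution (u : ℝ → L2 × L2) (ut uxx : ℝ → L2) (u₀ : L2 × L2) (u₁ : L2) :
    Prop where
  mem : ∀ t, 0 ≤ t → u t ∈ H10
  weak_deriv : ∀ t, 0 ≤ t → HasWeakDeriv (u t).2 (uxx t)
  cont : ContinuousOn u (Ici 0)
  cont_uxx : ContinuousOn uxx (Ici 0)
  deriv_u : ∀ t, 0 ≤ t → HasDerivWithinAt (fun s => (u s).1) (ut t) (Ici 0) t
  deriv_ut : ∀ t, 0 ≤ t → HasDerivWithinAt ut (uxx t) (Ici 0) t
  init_u : u 0 = u₀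
  init_ut : ut 0 = u₁
  data_u₁ : ∃ du₁ : L2, (u₁, du₁) ∈ H10

/-- The trace at `x ∈ [0, π]` of (the class of) a function `p` on `(0, π)` that has a continuous
representative on `[0, π]`, as every `p ∈ H¹(0, π)` does. -/
def HasTrace (p : L2) (x a : ℝ) : Prop :=
  ∃ P : ℝ → ℝ, ContinuousOn P (Icc 0 Real.pi) ∧ p =ᵐ[mu] P ∧ P x = a

/-- `g` is the boundary trace `t ↦ u_x(x, t)`, `t > 0`, at the endpoint `x ∈ {0, π}`, of the weak
solution with data `(u₀, u₁)`. It is understood in the sense of hidden regularity, i.e. through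
the extension by continuity, from `H¹₀ × L²` to `L²(0, T)` for every `T > 0`, of the map that sends
the data in `(H² ∩ H¹₀) × H¹₀` to the Sobolev trace of `u_x` for the strong solution `u`. -/
def IsBoundaryDeriv (u₀ : L2 × L2) (u₁ : L2) (x : ℝ) (g : ℝ → ℝ) : Prop :=
  (∀ T : ℝ, 0 < T → MemLp g 2 (volume.restrict (Ioo 0 T))) ∧
  ∃ (u₀s : ℕ → L2 × L2) (u₁s : ℕ → L2) (u : ℕ → ℝ → L2 × L2) (ut uxx : ℕ → ℝ → L2)
    (h : ℕ → ℝ → ℝ),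
    (∀ i, IsStrongSolution (u i) (ut i) (uxx i) (u₀s i) (u₁s i)) ∧
    (∀ i, ∀ t, 0 ≤ t → HasTrace (u i t).2 x (h i t)) ∧
    Tendsto u₀s atTop (𝓝 u₀) ∧ Tendsto u₁s atTop (𝓝 u₁) ∧
    ∀ T : ℝ, 0 < T →
      Tendsto (fun i => eLpNorm (h i - g) 2 (volume.restrict (Ioo 0 T))) atTop (𝓝 0)

/-- The initial energy `E₀ = ½ ∫ (|u₀'|² + |u₁|²)`. -/
noncomputable def energy (u₀ : L2 × L2) (u₁ : L2) : ℝ :=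
  (1 / 2) * ∫ x in Ioo 0 Real.pi, (|u₀.2 x| ^ 2 + |u₁ x| ^ 2)

/-- The observation endpoint: `λ_k = 0` for even `k`, `λ_k = π` for odd `k`. -/
noncomputable def endpoint (k : ℕ) : ℝ := if Even k then 0 else Real.pi

/-- Observability in time `T > 0` when the endpoint `λ_k` is observed during the
time interval `I k`. In the inequality `g y` is `t ↦ u_x(y, t)`. -/
def Observable (I : ℕ → Set ℝ) (T : ℝ) : Prop :=
  0 < T ∧ ∃ n : ℕ, ∃ c : ℝ, 0 < c ∧
    ∀ (u₀ : L2 × L2) (u₁ : L2), u₀ ∈ H10 →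
    ∀ (u : ℝ → L2 × L2) (ut : ℝ → L2), IsWeakSolution u ut u₀ u₁ →
    ∀ g : ℝ → ℝ → ℝ,
      IsBoundaryDeriv u₀ u₁ 0 (g 0) → IsBoundaryDeriv u₀ u₁ Real.pi (g Real.pi) →
      c * energy u₀ u₁ ≤
        ∑ k ∈ Finset.range (n + 1), ∫ t in I k ∩ Ioo 0 T, |g (endpoint k) t| ^ 2

/-- `T` is the optimal control time: the system is observable in time `T`, but in no smaller one. -/
def IsOptimalTime (I : ℕ → Set ℝ) (T : ℝ) : Prop :=
  Observable I T ∧ ∀ T' : ℝ, T' < T → ¬ Observable I T'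

/-- Exchange of the observation endpoint at the constant rate `T₀`: `I_k = (k T₀, (k+1) T₀)`. -/
def rateIntervals (T₀ : ℝ) (k : ℕ) : Set ℝ := Ioo (k * T₀) ((k + 1) * T₀)

/-- The map `T₀ ↦ T_opt(T₀)`; it equals the optimal control time wherever that one exists. -/
noncomputable def Topt (T₀ : ℝ) : ℝ := sInf {T | Observable (rateIntervals T₀) T}

/-- `B_k = (π/(k+1), π/(k+1/2))`. -/
noncomputable def B (k : ℕ) : Set ℝ := Ioo (Real.pi / (k + 1)) (Real.pi / (k + 1 / 2))

/-- `ξ_m = π / (k + (m+1)/(m+2))`. -/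
noncomputable def xi (k m : ℕ) : ℝ := Real.pi / (k + (m + 1) / (m + 2))

/-- Where the optimal control time exists, it is unique and is the value of `Topt`. -/
theorem IsOptimalTime.eq_Topt {T₀ T : ℝ} (h : IsOptimalTime (rateIntervals T₀) T) :
    Topt T₀ = T :=
  IsLeast.csInf_eq ⟨h.1, fun T' hT' => not_lt.mp fun hlt => h.2 T' hlt hT'⟩

end AlternatingWave

/-!
Every solution has the form `u(x, t) = F(t + x) - F(t - x)` with a `2π`-periodic `F`. With the
profile `f = F'` the traces are `u_x(0, t) = 2 f(t)` and `u_x(π, t) = 2 f(t + π)`, and the energy is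
`∫ f²` over a period. So the system is observable in time `T` exactly if, up to a null set, each
phase modulo `2π` equals `t` or `t + π` for a time `t < T` at which the endpoint `0`, respectively
`π`, is observed.

Put `δ = (k + 1) T₀ - π` (`drift`). For `T₀ ∈ B k` one has `0 < 2 δ < T₀`. As `k` is even, the pattern
of observed phases in the time between `q π` and `(q + 1) π` is, relative to the characteristics, the
initial pattern moved by `q δ`. A characteristic arriving at the boundary at the times `y + q π` is
thus observed or not according to the parity of `⌊(y - q δ) / T₀⌋`. Since the steps `δ` are shorter
than `T₀`, both parities have occurred once `q δ ≥ T₀`, that is, for `q = P = ⌈T₀ / δ⌉` (`passes`). The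
phases just below `k T₀` are the last to be observed; they arrive with `q = P` just before the time
`P π + k T₀` (`optTime`), which is therefore the optimal time: `exists_observed` gives the covering up
to this time and `not_observed_of_near` its failure before. The discontinuities are the points where
`T₀ / δ` is an integer, and these are the `ξ_m`, where `T₀ / δ = m + 2`.

The passage from the trace defined by approximation with strong solutions to the profile is by
duality. The pairing of a strong solution with a smooth solution that vanishes at one endpoint changes
in time only through the trace at the other endpoint (`IsStrongSolution.hasDerivWithinAt_pairing`).
If the smooth solution vanishes at time `T`, this expresses the trace on `(0, T)`, tested against any
test function, as a continuous functional of the data (`IsBoundaryDeriv.integral_eq`), which is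
evaluated in `IsBoundaryDeriv.ae_eq_profile`. Observability follows by integrating `f²` over the
covering (`observable_optTime`). Before the optimal time, d'Alembert's solution with a bump function
`F` such that `F'` lives on unobserved phases is a counterexample (`not_observable_of_lt`); that it is
a strong solution rests on the description of `H¹₀` by boundary values (`cls_mem_H10`).
-/

namespace AlternatingWave

/-! ### The alternating observation pattern -/

/-- The drift of the observation pattern: a half-period `π` of the wave falls short of `k + 1`
observation intervals by this amount. -/
noncomputable def drift (k : ℕ) (T₀ : ℝ) : ℝ := (k + 1) * T₀ - Real.pi

theorem B_pos {k : ℕ} {T₀ : ℝ} (h : T₀ ∈ B k) : 0 < T₀ :=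
  lt_trans (by positivity) h.1

theorem drift_pos {k : ℕ} {T₀ : ℝ} (h : T₀ ∈ B k) : 0 < drift k T₀ := by
  have h1 := h.1
  rw [div_lt_iff₀ (by positivity)] at h1
  unfold drift; linarith

theorem two_mul_drift_lt {k : ℕ} {T₀ : ℝ} (h : T₀ ∈ B k) : 2 * drift k T₀ < T₀ := by
  have h1 := h.2
  rw [lt_div_iff₀ (by positivity)] at h1
  unfold drift; linarith

/-- The number of half-periods after which the accumulated drift covers one interval. -/
noncomputable def passes (k : ℕ) (T₀ : ℝ) : ℕ := ⌈T₀ / drift k T₀⌉₊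

theorem le_passes_mul_drift {k : ℕ} {T₀ : ℝ} (h : T₀ ∈ B k) :
    T₀ ≤ passes k T₀ * drift k T₀ := by
  have := Nat.le_ceil (T₀ / drift k T₀)
  rwa [div_le_iff₀ (drift_pos h)] at this

theorem passes_sub_one_mul_drift_lt {k : ℕ} {T₀ : ℝ} (h : T₀ ∈ B k) :
    ((passes k T₀ : ℝ) - 1) * drift k T₀ < T₀ := by
  have := Nat.ceil_lt_add_one (div_pos (B_pos h) (drift_pos h)).le
  rw [← lt_div_iff₀ (drift_pos h)]
  unfold passes
  linarith

/-- The value of the optimal control time. -/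
noncomputable def optTime (k : ℕ) (T₀ : ℝ) : ℝ := passes k T₀ * Real.pi + k * T₀

theorem optTime_pos {k : ℕ} {T₀ : ℝ} (h : T₀ ∈ B k) : 0 < optTime k T₀ := by
  have h1 : 0 < passes k T₀ := Nat.ceil_pos.2 (div_pos (B_pos h) (drift_pos h))
  have h2 := B_pos h
  unfold optTime
  positivity

/-- A characteristic whose phase lies just below `k T₀` is not observed before the time `optTime`:
at each of its earlier arrivals `y + q π` at the boundary, the other endpoint is observed. -/
theorem not_observed_of_near {k : ℕ} (hk : Even k) {T₀ : ℝ} (h : T₀ ∈ B k) {ε y : ℝ}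
    (hε : ε + ((passes k T₀ : ℝ) - 1) * drift k T₀ < T₀)
    (hy : y ∈ Ioo (k * T₀ - ε) (k * T₀)) {q : ℤ} {j : ℕ} (hqj : Even (q - j))
    (hj : y + q * Real.pi ∈ rateIntervals T₀ j) (h0 : 0 < y + q * Real.pi) :
    optTime k T₀ - ε < y + q * Real.pi := by
  by_contra! hle
  have hT := B_pos h
  have hd := drift_pos h
  have hd2 := two_mul_drift_lt h
  have hpi := Real.pi_pos
  have hdrift : drift k T₀ = (k + 1) * T₀ - Real.pi := rfl
  obtain ⟨hy1, hy2⟩ := hy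
  obtain ⟨hj1, hj2⟩ := hj
  have hq1 : q < passes k T₀ := by
    have : (q : ℝ) * Real.pi < passes k T₀ * Real.pi := by
      unfold optTime at hle; linarith
    exact_mod_cast lt_of_mul_lt_mul_right this hpi.le
  have hq0 : -1 < q := by
    have : (-1 : ℝ) * Real.pi < q * Real.pi := by linarith
    exact_mod_cast lt_of_mul_lt_mul_right this hpi.le
  have hq0' : (0 : ℝ) ≤ q := by exact_mod_cast (by omega : 0 ≤ q)
  have hq1' : (q : ℝ) ≤ passes k T₀ - 1 := by
    have : q + 1 ≤ passes k T₀ := hq1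
    have : (q : ℝ) + 1 ≤ passes k T₀ := by exact_mod_cast this
    linarith
  have hm := mul_le_mul_of_nonneg_right hq1' hd.le
  have hm0 := mul_nonneg hq0' hd.le
  have hqpi : (q : ℝ) * Real.pi = q * (k + 1) * T₀ - q * drift k T₀ := by rw [hdrift]; ring
  have e1 : (j : ℤ) < k + q * (k + 1) := by
    have : (j : ℝ) * T₀ < (k + q * (k + 1)) * T₀ := by nlinarith
    exact_mod_cast lt_of_mul_lt_mul_right this hT.le
  have e2 : k + q * (k + 1) < (j : ℤ) + 2 := by
    have : (k + q * (k + 1)) * T₀ < ((j : ℝ) + 2) * T₀ := by nlinarith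
    exact_mod_cast lt_of_mul_lt_mul_right this hT.le
  have e3 : k + q * (k + 1) = (j : ℤ) + 1 := by omega
  have hk' : Even (k : ℤ) := by exact_mod_cast hk
  have hodd : Odd (q - (j : ℤ)) := by
    have : q - (j : ℤ) = 1 - (k + q * k) := by linarith
    rw [this]
    exact Odd.sub_even odd_one (hk'.add (hk'.mul_left _))
  exact (Int.not_even_iff_odd.2 hodd) hqj

/-- A sequence of integers that descends by steps of at most one and gets below its initial value
attains both parities. -/
theorem exists_even_add_of_descent {φ : ℕ → ℤ} {a p : ℕ} (hap : a ≤ p) (hφ : φ p < φ a)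
    (hstep : ∀ q, φ q ≤ φ (q + 1) + 1) (b : ℤ) : ∃ q, a ≤ q ∧ q ≤ p ∧ Even (φ q + b) := by
  classical
  have hex : ∃ n, φ (a + n) < φ a := ⟨p - a, by rwa [Nat.add_sub_cancel' hap]⟩
  have h1 := Nat.find_spec hex
  have hle : Nat.find hex ≤ p - a := Nat.find_min' hex (by rwa [Nat.add_sub_cancel' hap])
  have hpos : Nat.find hex ≠ 0 := by
    intro h0; rw [h0] at h1; simp at h1
  obtain ⟨n, hn⟩ := Nat.exists_eq_succ_of_ne_zero hpos
  have h2 : ¬ φ (a + n) < φ a := Nat.find_min hex (by omega)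
  have h3 := hstep (a + n)
  rw [hn] at h1 hle
  have h4 : φ (a + n + 1) = φ a - 1 := by
    have : a + n.succ = a + n + 1 := rfl
    rw [this] at h1
    omega
  rcases Int.even_or_odd (φ a + b) with he | ho
  · exact ⟨a, le_rfl, hap, he⟩
  · refine ⟨a + n + 1, by omega, by omega, ?_⟩
    rw [h4]
    have : φ a - 1 + b = φ a + b - 1 := by ring
    rw [this]
    exact ho.sub_odd odd_one

/-- Up to a null set of phases, each characteristic is observed before the time `optTime`. The
phases modulo `2 π` are represented by `y + b π` with `b` modulo `2` and `y` in a half-period. -/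
theorem exists_observed {k : ℕ} (hk : Even k) {T₀ : ℝ} (h : T₀ ∈ B k) {y : ℝ}
    (hy : y ∈ Ioo (k * T₀ - Real.pi) (k * T₀))
    (hgen : ∀ (q : ℕ) (n : ℤ), y + q * Real.pi ≠ n * T₀) (b : ℤ) :
    ∃ q ≤ passes k T₀, ∃ j : ℕ, y + q * Real.pi ∈ rateIntervals T₀ j ∧
      y + q * Real.pi ∈ Ioo 0 (optTime k T₀) ∧ Even ((q : ℤ) - j - b) := by
  have hT := B_pos h
  have hd := drift_pos h
  have hd2 := two_mul_drift_lt h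
  have hpi := Real.pi_pos
  have hdrift : drift k T₀ = (k + 1) * T₀ - Real.pi := rfl
  have hP := le_passes_mul_drift h
  obtain ⟨hy1, hy2⟩ := hy
  have hP1 : 1 ≤ passes k T₀ := Nat.ceil_pos.2 (div_pos hT hd)
  have hkT : 0 ≤ k * T₀ := by positivity
  let φ : ℕ → ℤ := fun q => ⌊(y - q * drift k T₀) / T₀⌋
  have hstep : ∀ q, φ q ≤ φ (q + 1) + 1 := by
    intro q
    simp only [φ]
    rw [← Int.floor_add_one]
    apply Int.floor_le_floor
    rw [div_add_one hT.ne']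
    apply div_le_div_of_nonneg_right _ hT.le
    push_cast
    linarith
  -- The first arrival is at `q = 0` or `q = 1`, depending on the sign of `y`.
  have key : ∃ a, a ≤ passes k T₀ ∧ φ (passes k T₀) < φ a ∧ 0 < y + a * Real.pi := by
    have hy0 : y ≠ 0 := by simpa using hgen 0 0
    rcases lt_or_gt_of_ne hy0 with hneg | hpos
    · refine ⟨1, hP1, ?_, ?_⟩
      · have e1 : -1 ≤ φ 1 := by
          simp only [φ]
          rw [Int.le_floor, le_div_iff₀ hT]
          push_cast
          linarith
        have e2 : φ (passes k T₀) < -1 := by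
          simp only [φ]
          rw [Int.floor_lt, div_lt_iff₀ hT]
          push_cast
          linarith
        omega
      · push_cast; linarith
    · refine ⟨0, Nat.zero_le _, ?_, by simpa using hpos⟩
      have e1 : φ (passes k T₀) + 1 ≤ φ 0 := by
        simp only [φ]
        rw [← Int.floor_add_one]
        apply Int.floor_le_floor
        rw [div_add_one hT.ne']
        apply div_le_div_of_nonneg_right _ hT.le
        push_cast
        linarith
      omega
  obtain ⟨a, haP, hφ, ha0⟩ := key
  obtain ⟨q, haq, hqP, hev⟩ := exists_even_add_of_descent haP hφ hstep b
  have hpos : 0 < y + q * Real.pi := by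
    have : (a : ℝ) * Real.pi ≤ q * Real.pi :=
      mul_le_mul_of_nonneg_right (by exact_mod_cast haq) hpi.le
    linarith
  have hfl : ⌊(y + q * Real.pi) / T₀⌋ = φ q + q * (k + 1) := by
    have : (y + q * Real.pi) / T₀ = (y - q * drift k T₀) / T₀ + ((q * (k + 1) : ℤ) : ℝ) := by
      rw [hdrift]; push_cast; field_simp; ring
    rw [this, Int.floor_add_intCast]
  have hnn : 0 ≤ ⌊(y + q * Real.pi) / T₀⌋ := Int.floor_nonneg.2 (div_pos hpos hT).le
  obtain ⟨j, hj⟩ := Int.eq_ofNat_of_zero_le hnn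
  have hjr : ((⌊(y + q * Real.pi) / T₀⌋ : ℤ) : ℝ) = j := by rw [hj]; simp
  refine ⟨q, hqP, j, ⟨?_, ?_⟩, ⟨hpos, ?_⟩, ?_⟩
  · have := Int.floor_le ((y + q * Real.pi) / T₀)
    rw [hjr, le_div_iff₀ hT] at this
    exact lt_of_le_of_ne this fun he => hgen q j (by rw [← he]; simp)
  · have := Int.lt_floor_add_one ((y + q * Real.pi) / T₀)
    rwa [hjr, div_lt_iff₀ hT] at this
  · have : (q : ℝ) * Real.pi ≤ passes k T₀ * Real.pi :=
      mul_le_mul_of_nonneg_right (by exact_mod_cast hqP) hpi.le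
    unfold optTime
    linarith
  · have hk' : Even (k : ℤ) := by exact_mod_cast hk
    have : (q : ℤ) - j - b = -(φ q + b) - q * k := by linarith
    rw [this]
    exact hev.neg.sub (hk'.mul_left _)

/-! ### Discontinuities of the optimal time -/

theorem xi_eq_mul_drift (k m : ℕ) : xi k m = (m + 2) * drift k (xi k m) := by
  unfold drift xi
  have : (k : ℝ) * (m + 2) + (m + 1) ≠ 0 := by positivity
  field_simp
  ring

theorem xi_mem_B (k : ℕ) {m : ℕ} (hm : 1 ≤ m) : xi k m ∈ B k := by
  have hm' : (1 : ℝ) ≤ m := by exact_mod_cast hm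
  constructor
  · apply div_lt_div_of_pos_left Real.pi_pos (by positivity)
    gcongr
    rw [div_lt_one (by positivity)]
    linarith
  · apply div_lt_div_of_pos_left Real.pi_pos (by positivity)
    have : (1 : ℝ) / 2 < (m + 1) / (m + 2) := by
      rw [div_lt_div_iff₀ (by positivity) (by positivity)]
      linarith
    linarith

theorem isOpen_B (k : ℕ) : IsOpen (B k) := isOpen_Ioo

theorem continuousAt_ratio {k : ℕ} {T₀ : ℝ} (h : T₀ ∈ B k) :
    ContinuousAt (fun T => T / drift k T) T₀ := by
  apply ContinuousAt.div continuousAt_id _ (drift_pos h).ne'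
  unfold drift
  fun_prop

theorem passes_eq_iff {k : ℕ} {T₀ : ℝ} {n : ℕ} :
    passes k T₀ = n + 1 ↔ (n : ℝ) < T₀ / drift k T₀ ∧ T₀ / drift k T₀ ≤ n + 1 := by
  unfold passes
  rw [Nat.ceil_eq_iff (by omega)]
  simp

/-- To the left of `ξ_m`, where the ratio of `T₀` and the drift is the integer `m + 2`, that ratio
is larger, and one more half-period is needed. -/
theorem eventually_passes_left (k : ℕ) {m : ℕ} (hm : 1 ≤ m) :
    ∀ᶠ T in 𝓝[<] (xi k m), T ∈ B k ∧ passes k T = m + 3 := by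
  have hB := xi_mem_B k hm
  have hx := xi_eq_mul_drift k m
  have hr : xi k m / drift k (xi k m) = m + 2 := by
    rw [div_eq_iff (drift_pos hB).ne']; exact hx
  have h1 : ∀ᶠ T in 𝓝 (xi k m), T / drift k T < m + 3 := by
    apply (continuousAt_ratio hB).eventually_lt_const
    simp only [hr]; linarith
  filter_upwards [nhdsWithin_le_nhds h1, nhdsWithin_le_nhds ((isOpen_B k).mem_nhds hB),
    self_mem_nhdsWithin] with T hT hTB hlt
  refine ⟨hTB, passes_eq_iff.2 ⟨?_, ?_⟩⟩
  · rw [lt_div_iff₀ (drift_pos hTB)]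
    have hlt' : T < xi k m := hlt
    have hm' : (1 : ℝ) ≤ m := by exact_mod_cast hm
    unfold drift at *
    push_cast
    have hk0 : (0 : ℝ) ≤ k := Nat.cast_nonneg k
    have : 0 < (((m : ℝ) + 2) * (k + 1) - 1) * (xi k m - T) :=
      mul_pos (by nlinarith) (by linarith)
    nlinarith
  · push_cast; linarith

theorem eventually_passes_right (k : ℕ) {m : ℕ} (hm : 1 ≤ m) :
    ∀ᶠ T in 𝓝[>] (xi k m), T ∈ B k ∧ passes k T = m + 2 := by
  have hB := xi_mem_B k hm
  have hx := xi_eq_mul_drift k m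
  have hr : xi k m / drift k (xi k m) = m + 2 := by
    rw [div_eq_iff (drift_pos hB).ne']; exact hx
  have h1 : ∀ᶠ T in 𝓝 (xi k m), (m : ℝ) + 1 < T / drift k T := by
    apply (continuousAt_ratio hB).eventually_const_lt
    simp only [hr]; linarith
  filter_upwards [nhdsWithin_le_nhds h1, nhdsWithin_le_nhds ((isOpen_B k).mem_nhds hB),
    self_mem_nhdsWithin] with T hT hTB hlt
  refine ⟨hTB, passes_eq_iff.2 ⟨by push_cast; linarith, ?_⟩⟩
  rw [div_le_iff₀ (drift_pos hTB)]
  have hlt' : xi k m < T := hlt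
  unfold drift at *
  push_cast
  have hk0 : (0 : ℝ) ≤ k := Nat.cast_nonneg k
  have hm0 : (0 : ℝ) ≤ m := Nat.cast_nonneg m
  have : 0 ≤ (((m : ℝ) + 2) * (k + 1) - 1) * (T - xi k m) :=
    mul_nonneg (by nlinarith) (by linarith)
  nlinarith

/-- Away from the points `ξ_m` the ratio of `T₀` and the drift is not an integer, so that its
ceiling is locally constant. -/
theorem eventually_passes_eq {k : ℕ} {T₀ : ℝ} (h : T₀ ∈ B k)
    (hne : ∀ m : ℕ, 1 ≤ m → T₀ ≠ xi k m) : ∀ᶠ T in 𝓝 T₀, passes k T = passes k T₀ := by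
  have hT := B_pos h
  have hd := drift_pos h
  have h2 : 2 < T₀ / drift k T₀ := by
    rw [lt_div_iff₀ hd]; exact two_mul_drift_lt h
  have hP : 2 < passes k T₀ := by
    have := h2.trans_le (Nat.le_ceil _)
    exact_mod_cast this
  obtain ⟨n, hn⟩ : ∃ n, passes k T₀ = n + 2 + 1 := ⟨passes k T₀ - 3, by omega⟩
  obtain ⟨h3, h4⟩ := passes_eq_iff.1 hn
  have h5 : T₀ / drift k T₀ < ((n + 2 : ℕ) : ℝ) + 1 := by
    refine lt_of_le_of_ne h4 fun he => hne (n + 1) (by omega) ?_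
    rw [div_eq_iff hd.ne'] at he
    unfold drift at he
    unfold xi
    push_cast at he ⊢
    have e : (k : ℝ) * (n + 3) + (n + 2) ≠ 0 := by positivity
    rw [eq_div_iff (by positivity)]
    field_simp
    linarith
  have c := continuousAt_ratio h
  rw [hn]
  filter_upwards [c.eventually_lt_const h5, c.eventually_const_lt h3] with T hT1 hT2
  exact passes_eq_iff.2 ⟨hT2, hT1.le⟩

/-- The analytic part of the proposition, deduced from the formula for the optimal time. -/
theorem discontinuities_of_formula {k : ℕ}
    (hopt : ∀ T₀ ∈ B k, IsOptimalTime (rateIntervals T₀) (optTime k T₀)) :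
    (∀ T₀ ∈ B k, IsOptimalTime (rateIntervals T₀) (Topt T₀)) ∧
    {T₀ | T₀ ∈ B k ∧ ¬ ContinuousWithinAt Topt (B k) T₀} = {T₀ | ∃ m : ℕ, 1 ≤ m ∧ T₀ = xi k m} ∧
    ∀ m : ℕ, 1 ≤ m →
      Tendsto Topt (𝓝[<] (xi k m)) (𝓝 (Real.pi * (m + 3) + k * xi k m)) ∧
      Tendsto Topt (𝓝[>] (xi k m)) (𝓝 (Real.pi * (m + 2) + k * xi k m)) ∧
      Function.leftLim Topt (xi k m) - Function.rightLim Topt (xi k m) = Real.pi := by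
  have hval : ∀ T₀ ∈ B k, Topt T₀ = optTime k T₀ := fun T₀ h => (hopt T₀ h).eq_Topt
  have hlin : ∀ (n : ℕ) (x : ℝ),
      Tendsto (fun T : ℝ => n * Real.pi + k * T) (𝓝 x) (𝓝 (n * Real.pi + k * x)) :=
    fun n x => Continuous.tendsto (by fun_prop) x
  have hleft : ∀ m : ℕ, 1 ≤ m →
      Tendsto Topt (𝓝[<] (xi k m)) (𝓝 (Real.pi * (m + 3) + k * xi k m)) := by
    intro m hm
    have h1 := (hlin (m + 3) (xi k m)).mono_left (nhdsWithin_le_nhds (s := Iio (xi k m)))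
    have e : ((m + 3 : ℕ) : ℝ) * Real.pi + k * xi k m = Real.pi * (m + 3) + k * xi k m := by
      push_cast; ring
    rw [e] at h1
    refine h1.congr' ?_
    filter_upwards [eventually_passes_left k hm] with T hT
    rw [hval T hT.1, optTime, hT.2]
  have hright : ∀ m : ℕ, 1 ≤ m →
      Tendsto Topt (𝓝[>] (xi k m)) (𝓝 (Real.pi * (m + 2) + k * xi k m)) := by
    intro m hm
    have h1 := (hlin (m + 2) (xi k m)).mono_left (nhdsWithin_le_nhds (s := Ioi (xi k m)))
    have e : ((m + 2 : ℕ) : ℝ) * Real.pi + k * xi k m = Real.pi * (m + 2) + k * xi k m := by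
      push_cast; ring
    rw [e] at h1
    refine h1.congr' ?_
    filter_upwards [eventually_passes_right k hm] with T hT
    rw [hval T hT.1, optTime, hT.2]
  refine ⟨fun T₀ h => (hval T₀ h).symm ▸ hopt T₀ h, ?_, fun m hm =>
    ⟨hleft m hm, hright m hm, ?_⟩⟩
  · ext T₀
    constructor
    · rintro ⟨hB, hdis⟩
      by_contra! hne
      apply hdis
      have hc : ContinuousAt (fun T : ℝ => (passes k T₀ : ℝ) * Real.pi + k * T) T₀ := by fun_prop
      refine (hc.congr ?_).continuousWithinAt
      filter_upwards [eventually_passes_eq hB fun m hm he => hne ⟨m, hm, he⟩,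
        (isOpen_B k).mem_nhds hB] with T hT hTB
      rw [hval T hTB, optTime, hT]
    · rintro ⟨m, hm, rfl⟩
      have hB := xi_mem_B k hm
      refine ⟨hB, fun hc => ?_⟩
      have hc' := hc.continuousAt ((isOpen_B k).mem_nhds hB)
      have e1 := tendsto_nhds_unique (hleft m hm) (hc'.mono_left nhdsWithin_le_nhds)
      have e2 := tendsto_nhds_unique (hright m hm) (hc'.mono_left nhdsWithin_le_nhds)
      have := Real.pi_pos
      linarith
  · rw [leftLim_eq_of_tendsto (hleft m hm), rightLim_eq_of_tendsto (hright m hm)]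
    ring

/-! ### Classes of continuous functions in `L²(0, π)` -/

theorem memLp_of_continuous {v : ℝ → ℝ} (hv : Continuous v) : MemLp v 2 mu := by
  obtain ⟨C, hC⟩ := (isCompact_Icc (a := (0 : ℝ)) (b := Real.pi)).exists_bound_of_continuousOn
    hv.continuousOn
  refine MemLp.of_bound hv.aestronglyMeasurable C ?_
  filter_upwards [ae_restrict_mem measurableSet_Ioo] with x hx
  exact hC x (Ioo_subset_Icc_self hx)

open Classical in
/-- The class in `L²(0, π)` of a function on `ℝ`; it is `0` if the function is not square integrable
on `(0, π)`, which does not occur for continuous functions. -/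
noncomputable def cls (v : ℝ → ℝ) : L2 := if h : MemLp v 2 mu then h.toLp v else 0

theorem cls_ae {v : ℝ → ℝ} (hv : Continuous v) : cls v =ᵐ[mu] v := by
  rw [cls, dif_pos (memLp_of_continuous hv)]
  exact MemLp.coeFn_toLp _

theorem eq_cls {v : ℝ → ℝ} (hv : Continuous v) {p : L2} (h : p =ᵐ[mu] v) : p = cls v :=
  Lp.ext (h.trans (cls_ae hv).symm)

theorem cls_add {v w : ℝ → ℝ} (hv : Continuous v) (hw : Continuous w) :
    cls (fun x => v x + w x) = cls v + cls w := by
  refine (eq_cls (hv.add hw) ?_).symm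
  filter_upwards [Lp.coeFn_add (cls v) (cls w), cls_ae hv, cls_ae hw] with x h1 h2 h3
  rw [h1, Pi.add_apply, h2, h3, Pi.add_apply]

theorem cls_sub {v w : ℝ → ℝ} (hv : Continuous v) (hw : Continuous w) :
    cls (fun x => v x - w x) = cls v - cls w := by
  refine (eq_cls (hv.sub hw) ?_).symm
  filter_upwards [Lp.coeFn_sub (cls v) (cls w), cls_ae hv, cls_ae hw] with x h1 h2 h3
  rw [h1, Pi.sub_apply, h2, h3, Pi.sub_apply]

theorem cls_const_mul {v : ℝ → ℝ} (c : ℝ) (hv : Continuous v) :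
    cls (fun x => c * v x) = c • cls v := by
  refine (eq_cls (hv.const_mul c) ?_).symm
  filter_upwards [Lp.coeFn_smul c (cls v), cls_ae hv] with x h1 h2
  rw [h1, Pi.smul_apply, h2, smul_eq_mul]

theorem inner_eq_integral (p q : L2) : inner ℝ p q = ∫ x in Ioo 0 Real.pi, p x * q x := by
  rw [L2.inner_def]
  refine integral_congr_ae (Eventually.of_forall fun x => ?_)
  simp [mul_comm]

theorem inner_cls (p : L2) {v : ℝ → ℝ} (hv : Continuous v) :
    inner ℝ p (cls v) = ∫ x in Ioo 0 Real.pi, p x * v x := by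
  rw [inner_eq_integral]
  refine integral_congr_ae ?_
  filter_upwards [cls_ae hv] with x hx
  rw [hx]

theorem norm_cls_le {v : ℝ → ℝ} (hv : Continuous v) {C : ℝ} (hC : 0 ≤ C)
    (h : ∀ x ∈ Ioo 0 Real.pi, |v x| ≤ C) :
    ‖cls v‖ ≤ (measureUnivNNReal mu ^ (2 : ENNReal).toReal⁻¹ : NNReal) * C := by
  rw [NNReal.coe_rpow]
  refine Lp.norm_le_of_ae_bound hC ?_
  filter_upwards [cls_ae hv, ae_restrict_mem measurableSet_Ioo] with x h1 h2
  rw [h1, Real.norm_eq_abs]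
  exact h x h2

/-- Translation of a `C¹` function is differentiable as a curve in `L²(0, π)`. -/
theorem hasDerivAt_cls {ψ : ℝ → ℝ} (hψ : ContDiff ℝ 1 ψ) {κ : ℝ → ℝ} (hκ : Continuous κ) (t : ℝ) :
    HasDerivAt (fun s => cls fun x => ψ (s + κ x)) (cls fun x => deriv ψ (t + κ x)) t := by
  have hc := hψ.continuous
  have hc' : Continuous (deriv ψ) := hψ.continuous_deriv le_rfl
  obtain ⟨M, hM⟩ := (isCompact_Icc (a := (0 : ℝ)) (b := Real.pi)).exists_bound_of_continuousOn
    hκ.continuousOn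
  set K : ℝ := ((measureUnivNNReal mu ^ (2 : ENNReal).toReal⁻¹ : NNReal) : ℝ) with hK
  have hK0 : 0 ≤ K := NNReal.coe_nonneg _
  -- Uniform continuity of `ψ'` on a compact interval that contains all arguments in play.
  have huc := (isCompact_Icc (a := t - M - 1) (b := t + M + 1)).uniformContinuousOn_of_continuous
    hc'.continuousOn
  rw [Metric.uniformContinuousOn_iff_le] at huc
  rw [hasDerivAt_iff_isLittleO, Asymptotics.isLittleO_iff]
  intro ε hε
  obtain ⟨δ, hδ, hδε⟩ := huc (ε / (K + 1)) (by positivity)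
  have hball : Metric.ball t (min δ 1) ∈ 𝓝 t := Metric.ball_mem_nhds _ (by positivity)
  filter_upwards [hball] with s hs
  rw [Metric.mem_ball, Real.dist_eq] at hs
  have hs1 : |s - t| < δ := hs.trans_le (min_le_left _ _)
  have hs2 : |s - t| < 1 := hs.trans_le (min_le_right _ _)
  rw [← cls_const_mul _ (by fun_prop), ← cls_sub (by fun_prop) (by fun_prop),
    ← cls_sub (by fun_prop) (by fun_prop)]
  refine (norm_cls_le (by fun_prop) (C := ε / (K + 1) * |s - t|) (by positivity) ?_).trans ?_
  · intro x hx
    have hMx := hM x (Ioo_subset_Icc_self hx)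
    rw [Real.norm_eq_abs, abs_le] at hMx
    have hseg : ∀ r ∈ uIcc t s, |r - t| ≤ |s - t| := fun r hr => by
      rcases le_total t s with h | h
      · rw [uIcc_of_le h] at hr
        rw [abs_of_nonneg (by linarith [hr.1]), abs_of_nonneg (by linarith)]; linarith [hr.2]
      · rw [uIcc_of_ge h] at hr
        rw [abs_of_nonpos (by linarith [hr.2]), abs_of_nonpos (by linarith)]; linarith [hr.1]
    have hd : ∀ r ∈ uIcc t s, HasDerivWithinAt
        (fun r => ψ (r + κ x) - r * deriv ψ (t + κ x))
        (deriv ψ (r + κ x) - deriv ψ (t + κ x)) (uIcc t s) r := by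
      intro r _
      have h1 : HasDerivAt (fun r => ψ (r + κ x)) (deriv ψ (r + κ x)) r := by
        have := ((hψ.differentiable one_ne_zero) (r + κ x)).hasDerivAt
        exact this.comp_add_const r (κ x)
      have h2 : HasDerivAt (fun r : ℝ => r * deriv ψ (t + κ x)) (deriv ψ (t + κ x)) r := by
        simpa using (hasDerivAt_id r).mul_const (deriv ψ (t + κ x))
      exact (h1.sub h2).hasDerivWithinAt
    have hb : ∀ r ∈ uIcc t s, ‖deriv ψ (r + κ x) - deriv ψ (t + κ x)‖ ≤ ε / (K + 1) := by
      intro r hr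
      have h1 := hseg r hr
      have h2 := abs_lt.1 (h1.trans_lt hs2)
      rw [← dist_eq_norm]
      refine hδε _ ⟨by linarith, by linarith⟩ _ ⟨by linarith, by linarith⟩ ?_
      rw [Real.dist_eq, add_sub_add_right_eq_sub]
      linarith
    have := (convex_uIcc t s).norm_image_sub_le_of_norm_hasDerivWithin_le hd hb
      left_mem_uIcc right_mem_uIcc
    rw [Real.norm_eq_abs, Real.norm_eq_abs] at this
    convert this using 2
    ring
  · rw [← hK, Real.norm_eq_abs, ← mul_assoc]
    gcongr
    rw [mul_div_assoc', div_le_iff₀ (by positivity)]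
    nlinarith

/-! ### Integration by parts -/

theorem IsTest.apply_zero {φ : ℝ → ℝ} (h : IsTest φ) : φ 0 = 0 :=
  image_eq_zero_of_notMem_tsupport fun h0 => (lt_irrefl _ (h.2.2 h0).1)

theorem IsTest.apply_pi {φ : ℝ → ℝ} (h : IsTest φ) : φ Real.pi = 0 :=
  image_eq_zero_of_notMem_tsupport fun h0 => (lt_irrefl _ (h.2.2 h0).2)

theorem IsTest.contDiff_one {φ : ℝ → ℝ} (h : IsTest φ) : ContDiff ℝ 1 φ :=
  h.1.of_le (by exact_mod_cast le_top)

theorem IsTest.continuous {φ : ℝ → ℝ} (h : IsTest φ) : Continuous φ := h.1.continuous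

theorem IsTest.continuous_deriv {φ : ℝ → ℝ} (h : IsTest φ) : Continuous (deriv φ) :=
  h.contDiff_one.continuous_deriv le_rfl

theorem IsTest.mem_H10 {φ : ℝ → ℝ} (h : IsTest φ) : (cls φ, cls (deriv φ)) ∈ H10 :=
  subset_closure ⟨φ, h, cls_ae h.continuous, cls_ae h.continuous_deriv⟩

theorem integral_Ioo_eq_intervalIntegral (v : ℝ → ℝ) :
    ∫ x in Ioo 0 Real.pi, v x = ∫ x in (0)..Real.pi, v x := by
  rw [intervalIntegral.integral_of_le Real.pi_pos.le, integral_Ioc_eq_integral_Ioo]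

/-- Integration by parts against elements of `H¹₀(0, π)` has no boundary terms. -/
theorem inner_snd_eq_of_mem_H10 {w : L2 × L2} (hw : w ∈ H10) {b : ℝ → ℝ} (hb : ContDiff ℝ 1 b) :
    inner ℝ w.2 (cls b) = - inner ℝ w.1 (cls (deriv b)) := by
  have hbc := hb.continuous
  have hbc' := hb.continuous_deriv le_rfl
  have hclosed : IsClosed {w : L2 × L2 |
      inner ℝ w.2 (cls b) = - inner ℝ w.1 (cls (deriv b))} :=
    isClosed_eq (by fun_prop) (by fun_prop)
  refine closure_minimal ?_ hclosed hw
  rintro w ⟨φ, hφ, h1, h2⟩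
  change inner ℝ w.2 (cls b) = - inner ℝ w.1 (cls (deriv b))
  rw [eq_cls hφ.continuous h1, eq_cls hφ.continuous_deriv h2, real_inner_comm,
    real_inner_comm _ (cls φ), inner_cls _ hφ.continuous, inner_cls _ hφ.continuous_deriv]
  have e1 : ∫ x in Ioo 0 Real.pi, cls b x * deriv φ x
      = ∫ x in Ioo 0 Real.pi, b x * deriv φ x := integral_congr_ae (by
    filter_upwards [cls_ae hbc] with x hx; rw [hx])
  have e2 : ∫ x in Ioo 0 Real.pi, cls (deriv b) x * φ x
      = ∫ x in Ioo 0 Real.pi, deriv b x * φ x := integral_congr_ae (by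
    filter_upwards [cls_ae hbc'] with x hx; rw [hx])
  rw [e1, e2, integral_Ioo_eq_intervalIntegral, integral_Ioo_eq_intervalIntegral,
    intervalIntegral.integral_mul_deriv_eq_deriv_mul (u' := deriv b)
      (fun x _ => (hb.differentiable one_ne_zero x).hasDerivAt)
      (fun x _ => (hφ.contDiff_one.differentiable one_ne_zero x).hasDerivAt)
      (hbc'.intervalIntegrable _ _) (hφ.continuous_deriv.intervalIntegrable _ _),
    hφ.apply_zero, hφ.apply_pi]
  simp

theorem exists_Icc_of_isCompact_subset_Ioo {K : Set ℝ} (hK : IsCompact K) {a b : ℝ}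
    (h : K ⊆ Ioo a b) (hab : a < b) : ∃ α β, a < α ∧ β < b ∧ K ⊆ Icc α β := by
  rcases K.eq_empty_or_nonempty with rfl | hne
  · obtain ⟨m, hm1, hm2⟩ := exists_between hab
    exact ⟨m, m, hm1, hm2, empty_subset _⟩
  · obtain ⟨α, hα⟩ := hK.exists_isLeast hne
    obtain ⟨β, hβ⟩ := hK.exists_isGreatest hne
    exact ⟨α, β, (h hα.1).1, (h hβ.1).2, fun x hx => ⟨hα.2 hx, hβ.2 hx⟩⟩

/-- A test function of mean zero is the derivative of a test function. -/
theorem IsTest.exists_primitive {η : ℝ → ℝ} (h : IsTest η)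
    (h0 : ∫ x in Ioo 0 Real.pi, η x = 0) : ∃ φ, IsTest φ ∧ deriv φ = η := by
  obtain ⟨α, β, hα, hβ, hK⟩ :=
    exists_Icc_of_isCompact_subset_Ioo h.2.1.isCompact h.2.2 Real.pi_pos
  have hz : ∀ x, x ∉ Icc α β → η x = 0 := fun x hx =>
    image_eq_zero_of_notMem_tsupport fun hx' => hx (hK hx')
  have hii : ∀ a b, IntervalIntegrable η volume a b := fun a b =>
    h.continuous.intervalIntegrable a b
  have hd : ∀ x, HasDerivAt (fun x => ∫ y in (0)..x, η y) (η x) x := fun x =>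
    intervalIntegral.integral_hasDerivAt_right (hii _ _)
      (h.continuous.stronglyMeasurableAtFilter _ _) h.continuous.continuousAt
  have hderiv : deriv (fun x => ∫ y in (0)..x, η y) = η := funext fun x => (hd x).deriv
  have hsupp : ∀ x, x ∉ Icc α β → ∫ y in (0)..x, η y = 0 := by
    intro x hx
    rcases lt_or_ge x α with hlt | hge
    · refine (intervalIntegral.integral_congr (g := fun _ => (0 : ℝ)) ?_).trans
        intervalIntegral.integral_zero
      refine fun y hy => hz y fun hy' => ?_
      rcases le_total 0 x with h' | h'
      · rw [uIcc_of_le h'] at hy; linarith [hy.2, hy'.1]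
      · rw [uIcc_of_ge h'] at hy; linarith [hy.2, hy'.1]
    · have hxβ : β < x := by
        by_contra! hle; exact hx ⟨hge, hle⟩
      rw [integral_Ioo_eq_intervalIntegral] at h0
      rw [← intervalIntegral.integral_add_adjacent_intervals (hii 0 Real.pi) (hii Real.pi x),
        h0, zero_add]
      refine (intervalIntegral.integral_congr (g := fun _ => (0 : ℝ)) ?_).trans
        intervalIntegral.integral_zero
      refine fun y hy => hz y fun hy' => ?_
      rcases le_total Real.pi x with h' | h'
      · rw [uIcc_of_le h'] at hy; linarith [hy.1, hy'.2]
      · rw [uIcc_of_ge h'] at hy; linarith [hy.1, hy'.2]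
  refine ⟨fun x => ∫ y in (0)..x, η y, ⟨?_, ?_, ?_⟩, hderiv⟩
  · rw [contDiff_infty_iff_deriv, hderiv]
    exact ⟨fun x => (hd x).differentiableAt, h.1⟩
  · exact HasCompactSupport.intro isCompact_Icc hsupp
  · refine (closure_minimal (fun x hx => ?_) isClosed_Icc).trans
      (fun x (hx : x ∈ Icc α β) => ⟨hα.trans_le hx.1, hx.2.trans_lt hβ⟩)
    by_contra hx'
    exact hx (hsupp x hx')

theorem exists_isTest_integral_eq_one :
    ∃ θ : ℝ → ℝ, IsTest θ ∧ ∫ x in Ioo 0 Real.pi, θ x = 1 := by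
  have hpi := Real.pi_pos
  let f : ContDiffBump (Real.pi / 2) := ⟨Real.pi / 8, Real.pi / 4, by positivity, by linarith⟩
  have hsub : tsupport (f.normed volume) ⊆ Ioo 0 Real.pi := by
    rw [f.tsupport_normed_eq, Real.closedBall_eq_Icc]
    have : f.rOut = Real.pi / 4 := rfl
    rw [this]
    exact fun x hx => ⟨by linarith [hx.1], by linarith [hx.2]⟩
  refine ⟨f.normed volume, ⟨f.contDiff_normed, f.hasCompactSupport_normed, hsub⟩, ?_⟩
  rw [setIntegral_eq_integral_of_forall_compl_eq_zero, f.integral_normed]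
  exact fun x hx => image_eq_zero_of_notMem_tsupport fun h => hx (hsub h)

theorem L2.integrable (p : L2) : Integrable p mu := (Lp.memLp p).integrable (by norm_num)

theorem integrable_mul_of_continuous {p : ℝ → ℝ} (hp : IntegrableOn p (Ioo 0 Real.pi))
    {v : ℝ → ℝ} (hv : Continuous v) :
    IntegrableOn (fun x => p x * v x) (Ioo 0 Real.pi) := by
  obtain ⟨C, hC⟩ := (isCompact_Icc (a := (0 : ℝ)) (b := Real.pi)).exists_bound_of_continuousOn
    hv.continuousOn
  refine Integrable.mul_bdd (c := C) hp hv.aestronglyMeasurable ?_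
  filter_upwards [ae_restrict_mem measurableSet_Ioo] with x hx
  exact hC x (Ioo_subset_Icc_self hx)

/-- The lemma of du Bois-Reymond: a function whose weak derivative vanishes is constant. -/
theorem ae_eq_const_of_weak_deriv_zero {w : ℝ → ℝ} (hw : IntegrableOn w (Ioo 0 Real.pi))
    (h : ∀ φ, IsTest φ → ∫ x in Ioo 0 Real.pi, w x * deriv φ x = 0) :
    ∃ c, w =ᵐ[mu] fun _ => c := by
  obtain ⟨θ, hθ, hθ1⟩ := exists_isTest_integral_eq_one
  set c := ∫ x in Ioo 0 Real.pi, w x * θ x with hc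
  refine ⟨c, ?_⟩
  have hint : IntegrableOn (fun x => w x - c) (Ioo 0 Real.pi) :=
    hw.sub (integrable_const c)
  have key : ∀ᵐ x, x ∈ Ioo 0 Real.pi → w x - c = 0 := by
    refine isOpen_Ioo.ae_eq_zero_of_integral_contDiff_smul_eq_zero hint.locallyIntegrableOn ?_
    intro η h1 h2 h3
    have hη : IsTest η := ⟨h1, h2, h3⟩
    have hηi : IntegrableOn η (Ioo 0 Real.pi) := by
      simpa using integrable_mul_of_continuous (p := fun _ => 1) (integrable_const 1)
        hη.continuous
    have hθi : IntegrableOn θ (Ioo 0 Real.pi) := by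
      simpa using integrable_mul_of_continuous (p := fun _ => 1) (integrable_const 1)
        hθ.continuous
    set m := ∫ x in Ioo 0 Real.pi, η x with hm
    have ht : IsTest fun x => η x - m * θ x := by
      refine ⟨h1.sub (contDiff_const.mul hθ.1), ?_, ?_⟩
      · exact h2.sub (hθ.2.1.mul_left (f := fun _ => m))
      · refine (tsupport_sub _ _).trans (union_subset h3 ?_)
        exact (tsupport_mul_subset_right (f := fun _ => m)).trans hθ.2.2
    have ht0 : ∫ x in Ioo 0 Real.pi, (η x - m * θ x) = 0 := by
      rw [integral_sub hηi (hθi.const_mul m), integral_const_mul, hθ1, ← hm]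
      ring
    obtain ⟨φ, hφ, hφ'⟩ := ht.exists_primitive ht0
    have h4 := h φ hφ
    rw [hφ'] at h4
    have hwη := integrable_mul_of_continuous hw hη.continuous
    have hwθ := integrable_mul_of_continuous hw hθ.continuous
    have h5 : ∫ x in Ioo 0 Real.pi, w x * (η x - m * θ x)
        = (∫ x in Ioo 0 Real.pi, w x * η x) - m * c := by
      rw [hc, ← integral_const_mul, ← integral_sub hwη (hwθ.const_mul m)]
      exact integral_congr_ae (Eventually.of_forall fun x => by ring)
    rw [h5] at h4
    rw [← setIntegral_eq_integral_of_forall_compl_eq_zero (s := Ioo 0 Real.pi)]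
    · have h6 : ∫ x in Ioo 0 Real.pi, η x • (w x - c)
          = (∫ x in Ioo 0 Real.pi, w x * η x) - c * m := by
        rw [hm, ← integral_const_mul, ← integral_sub hwη (hηi.const_mul c)]
        exact integral_congr_ae (Eventually.of_forall fun x => by
          simp only [smul_eq_mul]; ring)
      rw [h6]; linarith
    · intro x hx
      rw [image_eq_zero_of_notMem_tsupport fun h' => hx (h3 h'), zero_smul]
  rw [EventuallyEq, ae_restrict_iff' measurableSet_Ioo]
  filter_upwards [key] with x hx hx'
  linarith [hx hx']

theorem intervalIntegrable_of_Ioo {q : ℝ → ℝ} (hq : IntegrableOn q (Ioo 0 Real.pi)) :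
    IntervalIntegrable q volume 0 Real.pi := by
  rwa [intervalIntegrable_iff_integrableOn_Ioo_of_le Real.pi_pos.le]

theorem continuousOn_primitive_Icc {q : ℝ → ℝ} (hq : IntegrableOn q (Ioo 0 Real.pi)) :
    ContinuousOn (fun x => ∫ y in (0)..x, q y) (Icc 0 Real.pi) := by
  rw [← uIcc_of_le Real.pi_pos.le]
  refine intervalIntegral.continuousOn_primitive_interval' (intervalIntegrable_of_Ioo hq)
    left_mem_uIcc

/-- Integration by parts for the primitive of an integrable function. -/
theorem integral_primitive_mul_deriv {q : ℝ → ℝ} (hq : IntegrableOn q (Ioo 0 Real.pi))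
    {a : ℝ → ℝ} (ha : ContDiff ℝ 1 a) :
    ∫ x in Ioo 0 Real.pi, (∫ y in (0)..x, q y) * deriv a x
      = (∫ y in (0)..Real.pi, q y) * a Real.pi - ∫ x in Ioo 0 Real.pi, q x * a x := by
  have hqi := intervalIntegrable_of_Ioo hq
  have hac := hqi.absolutelyContinuousOnInterval_intervalIntegral (c := 0) left_mem_uIcc
  have haa : AbsolutelyContinuousOnInterval a 0 Real.pi :=
    ha.contDiffOn.absolutelyContinuousOnInterval
  have := hac.integral_mul_deriv_eq_deriv_mul haa
  rw [integral_Ioo_eq_intervalIntegral, this, integral_Ioo_eq_intervalIntegral]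
  simp only [intervalIntegral.integral_same, zero_mul, sub_zero]
  congr 1
  refine intervalIntegral.integral_congr_ae ?_
  filter_upwards [hqi.ae_hasDerivAt_integral] with x hx hx'
  rw [(hx (uIoc_subset_uIcc hx') 0 left_mem_uIcc).deriv]

/-- Integration by parts in `H¹(0, π)`, the boundary values being those of the continuous
representative. -/
theorem integral_add_eq_of_hasWeakDeriv {p q : L2} (hpq : HasWeakDeriv p q) {P : ℝ → ℝ}
    (hP : ContinuousOn P (Icc 0 Real.pi)) (hpP : p =ᵐ[mu] P) {a : ℝ → ℝ} (ha : ContDiff ℝ 1 a) :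
    inner ℝ q (cls a) + inner ℝ p (cls (deriv a)) = P Real.pi * a Real.pi - P 0 * a 0 := by
  have hpi := Real.pi_pos
  have hq : IntegrableOn q (Ioo 0 Real.pi) := L2.integrable q
  have hp : IntegrableOn p (Ioo 0 Real.pi) := L2.integrable p
  have ha' := ha.continuous_deriv le_rfl
  set Q : ℝ → ℝ := fun x => ∫ y in (0)..x, q y with hQ
  have hQc : ContinuousOn Q (Icc 0 Real.pi) := continuousOn_primitive_Icc hq
  have hQi : IntegrableOn Q (Ioo 0 Real.pi) :=
    (hQc.integrableOn_Icc).mono_set Ioo_subset_Icc_self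
  obtain ⟨c, hc⟩ := ae_eq_const_of_weak_deriv_zero (hp.sub hQi) (by
    intro φ hφ
    have h1 := integral_primitive_mul_deriv hq hφ.contDiff_one
    rw [hφ.apply_pi, mul_zero, zero_sub] at h1
    have h2 := hpq φ hφ
    have h3 := integral_sub (integrable_mul_of_continuous hp hφ.continuous_deriv)
      (integrable_mul_of_continuous hQi hφ.continuous_deriv)
    rw [h2, h1, sub_self] at h3
    refine (integral_congr_ae (Eventually.of_forall fun x => ?_)).trans h3
    simp only [Pi.sub_apply]; ring)
  have hPQ : EqOn P (fun x => c + Q x) (Icc 0 Real.pi) := by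
    have hcl : Icc 0 Real.pi ⊆ closure (Ioo 0 Real.pi) := by rw [closure_Ioo hpi.ne]
    have hoo : EqOn P (fun x => c + Q x) (Ioo 0 Real.pi) := by
      refine MeasureTheory.Measure.eqOn_open_of_ae_eq (μ := volume) ?_ isOpen_Ioo
        (hP.mono Ioo_subset_Icc_self) ((continuousOn_const.add hQc).mono Ioo_subset_Icc_self)
      filter_upwards [hc, hpP] with x h1 h2
      simp only [Pi.sub_apply] at h1
      rw [← h2]; linarith
    exact hoo.of_subset_closure hP (continuousOn_const.add hQc) Ioo_subset_Icc_self hcl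
  have e0 : P 0 = c := by
    rw [hPQ (left_mem_Icc.2 hpi.le), hQ]; simp
  have e1 : P Real.pi = c + Q Real.pi := hPQ (right_mem_Icc.2 hpi.le)
  rw [inner_cls _ ha.continuous, inner_cls _ ha']
  have e2 : ∫ x in Ioo 0 Real.pi, p x * deriv a x
      = (∫ x in Ioo 0 Real.pi, c * deriv a x) + ∫ x in Ioo 0 Real.pi, Q x * deriv a x := by
    rw [← integral_add (integrable_mul_of_continuous (integrable_const c) ha')
      (integrable_mul_of_continuous hQi ha')]
    refine integral_congr_ae ?_
    filter_upwards [hc] with x hx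
    simp only [Pi.sub_apply] at hx
    rw [← add_mul, ← hx]; ring
  have e3 : ∫ x in Ioo 0 Real.pi, c * deriv a x = c * (a Real.pi - a 0) := by
    rw [integral_const_mul, integral_Ioo_eq_intervalIntegral,
      intervalIntegral.integral_deriv_eq_sub' a rfl
        (fun x _ => ha.differentiable one_ne_zero x) ha'.continuousOn]
  rw [e2, e3, integral_primitive_mul_deriv hq ha, e0, e1]
  ring

/-! ### The boundary trace as a functional of the data -/

/-- The function `ψ(t + x - e) - ψ(t - x + e)` of `x`, a solution of the wave equation that is odd
about `x = e` and hence vanishes there. -/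
noncomputable def waveOdd (ψ : ℝ → ℝ) (e t : ℝ) : L2 :=
  cls (fun x => ψ (t + (x - e))) - cls (fun x => ψ (t + (e - x)))

/-- The function `ψ(t + x - e) + ψ(t - x + e)` of `x`, a solution of the wave equation that is
even about `x = e`. -/
noncomputable def waveEven (ψ : ℝ → ℝ) (e t : ℝ) : L2 :=
  cls (fun x => ψ (t + (x - e))) + cls (fun x => ψ (t + (e - x)))

theorem waveOdd_eq_cls {ψ : ℝ → ℝ} (hψ : Continuous ψ) (e t : ℝ) :
    waveOdd ψ e t = cls fun x => ψ (t + (x - e)) - ψ (t + (e - x)) :=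
  (cls_sub (by fun_prop) (by fun_prop)).symm

theorem waveEven_eq_cls {ψ : ℝ → ℝ} (hψ : Continuous ψ) (e t : ℝ) :
    waveEven ψ e t = cls fun x => ψ (t + (x - e)) + ψ (t + (e - x)) :=
  (cls_add (by fun_prop) (by fun_prop)).symm

theorem hasDerivAt_waveOdd {ψ : ℝ → ℝ} (hψ : ContDiff ℝ 1 ψ) (e t : ℝ) :
    HasDerivAt (waveOdd ψ e) (waveOdd (deriv ψ) e t) t :=
  (hasDerivAt_cls hψ (by fun_prop) t).sub (hasDerivAt_cls hψ (by fun_prop) t)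

theorem hasDerivAt_waveEven {ψ : ℝ → ℝ} (hψ : ContDiff ℝ 1 ψ) (e t : ℝ) :
    HasDerivAt (waveEven ψ e) (waveEven (deriv ψ) e t) t :=
  (hasDerivAt_cls hψ (by fun_prop) t).add (hasDerivAt_cls hψ (by fun_prop) t)

theorem contDiff_wave_profiles {ψ : ℝ → ℝ} {n : WithTop ℕ∞} (hψ : ContDiff ℝ n ψ) (e t : ℝ) :
    ContDiff ℝ n (fun x => ψ (t + (x - e)) - ψ (t + (e - x))) ∧
    ContDiff ℝ n (fun x => ψ (t + (x - e)) + ψ (t + (e - x))) := by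
  have h1 : ContDiff ℝ n fun x => ψ (t + (x - e)) := hψ.comp (by fun_prop)
  have h2 : ContDiff ℝ n fun x => ψ (t + (e - x)) := hψ.comp (by fun_prop)
  exact ⟨h1.sub h2, h1.add h2⟩

theorem hasDerivAt_wave_summands {ψ : ℝ → ℝ} (hψ : ContDiff ℝ 1 ψ) (e t x : ℝ) :
    HasDerivAt (fun x => ψ (t + (x - e))) (deriv ψ (t + (x - e))) x ∧
    HasDerivAt (fun x => ψ (t + (e - x))) (- deriv ψ (t + (e - x))) x := by
  have hd := fun y => (hψ.differentiable one_ne_zero y).hasDerivAt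
  constructor
  · have := (hd (t + (x - e))).comp x (((hasDerivAt_id x).sub_const e).const_add t)
    simpa [Function.comp_def] using this
  · have := (hd (t + (e - x))).comp x (((hasDerivAt_id x).const_sub e).const_add t)
    simpa [Function.comp_def] using this

theorem deriv_odd_profile {ψ : ℝ → ℝ} (hψ : ContDiff ℝ 1 ψ) (e t : ℝ) :
    deriv (fun x => ψ (t + (x - e)) - ψ (t + (e - x)))
      = fun x => deriv ψ (t + (x - e)) + deriv ψ (t + (e - x)) := by
  funext x
  obtain ⟨h1, h2⟩ := hasDerivAt_wave_summands hψ e t x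
  rw [(h1.fun_sub h2).deriv, sub_neg_eq_add]

theorem deriv_even_profile {ψ : ℝ → ℝ} (hψ : ContDiff ℝ 1 ψ) (e t : ℝ) :
    deriv (fun x => ψ (t + (x - e)) + ψ (t + (e - x)))
      = fun x => deriv ψ (t + (x - e)) - deriv ψ (t + (e - x)) := by
  funext x
  obtain ⟨h1, h2⟩ := hasDerivAt_wave_summands hψ e t x
  rw [(h1.fun_add h2).deriv, ← sub_eq_add_neg]

theorem inner_snd_waveEven {w : L2 × L2} (hw : w ∈ H10) {ψ : ℝ → ℝ} (hψ : ContDiff ℝ 1 ψ)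
    (e t : ℝ) : inner ℝ w.2 (waveEven ψ e t) = - inner ℝ w.1 (waveOdd (deriv ψ) e t) := by
  rw [waveEven_eq_cls hψ.continuous, waveOdd_eq_cls (hψ.continuous_deriv le_rfl),
    inner_snd_eq_of_mem_H10 hw (contDiff_wave_profiles hψ e t).2, deriv_even_profile hψ]

theorem waveOdd_eq_zero {ψ : ℝ → ℝ} (hψ : Continuous ψ) {e t : ℝ} (he : e ∈ Icc 0 Real.pi)
    (h : ∀ s, t - Real.pi < s → ψ s = 0) : waveOdd ψ e t = 0 := by
  rw [waveOdd_eq_cls hψ]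
  refine Lp.ext ?_
  filter_upwards [cls_ae (v := fun x => ψ (t + (x - e)) - ψ (t + (e - x))) (by fun_prop),
    Lp.coeFn_zero ℝ 2 mu, ae_restrict_mem measurableSet_Ioo] with x h1 h2 hx
  rw [h1, h2, h _ (by linarith [hx.1, he.2]), h _ (by linarith [hx.2, he.1])]
  simp

section Strong

variable {u : ℝ → L2 × L2} {ut uxx : ℝ → L2} {u₀ : L2 × L2} {u₁ : L2} {h : ℝ → ℝ} {e : ℝ}

/-- The trace at the endpoint `π - e` in terms of a test profile `a` that vanishes at `e`. -/
theorem IsStrongSolution.inner_eq_trace (hu : IsStrongSolution u ut uxx u₀ u₁)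
    (he : e = 0 ∨ e = Real.pi) (hh : ∀ t, 0 ≤ t → HasTrace (u t).2 (Real.pi - e) (h t))
    {a : ℝ → ℝ} (ha : ContDiff ℝ 1 a) (hae : a e = 0) {t : ℝ} (ht : 0 ≤ t) :
    inner ℝ (uxx t) (cls a) + inner ℝ (u t).2 (cls (deriv a))
      = h t * (a Real.pi - a 0) := by
  obtain ⟨P, hP, hpP, hPx⟩ := hh t ht
  rw [integral_add_eq_of_hasWeakDeriv (hu.weak_deriv t ht) hP hpP ha, ← hPx]
  rcases he with rfl | rfl
  · simp [hae]
  · simp [hae]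

theorem IsStrongSolution.continuousOn_trace (hu : IsStrongSolution u ut uxx u₀ u₁)
    (he : e = 0 ∨ e = Real.pi) (hh : ∀ t, 0 ≤ t → HasTrace (u t).2 (Real.pi - e) (h t)) :
    ContinuousOn h (Ici 0) := by
  have hpi := Real.pi_pos
  -- Testing with a time-independent linear profile expresses `h` through continuous curves.
  have ha : ContDiff ℝ 1 fun x : ℝ => (x - e) / Real.pi := by fun_prop
  have hc : ContinuousOn (fun t => inner ℝ (uxx t) (cls fun x : ℝ => (x - e) / Real.pi)
      + inner ℝ (u t).2 (cls (deriv fun x : ℝ => (x - e) / Real.pi))) (Ici 0) :=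
    (hu.cont_uxx.inner continuousOn_const).add
      ((continuous_snd.comp_continuousOn hu.cont).inner continuousOn_const)
  refine hc.congr fun t ht => ?_
  have := hu.inner_eq_trace he hh ha (by simp) ht
  simp only [this]
  field_simp
  ring

/-- The pairing of a strong solution with the smooth solution `waveOdd ψ e` changes only through
the boundary values at the endpoint `π - e`. -/
theorem IsStrongSolution.hasDerivWithinAt_pairing (hu : IsStrongSolution u ut uxx u₀ u₁)
    (he : e = 0 ∨ e = Real.pi) (hh : ∀ t, 0 ≤ t → HasTrace (u t).2 (Real.pi - e) (h t))
    {ψ : ℝ → ℝ} (hψ : ContDiff ℝ 2 ψ) {t : ℝ} (ht : 0 ≤ t) :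
    HasDerivWithinAt
      (fun s => inner ℝ (ut s) (waveOdd ψ e s) - inner ℝ (u s).1 (waveOdd (deriv ψ) e s))
      (h t * (ψ (t + Real.pi) - ψ (t - Real.pi))) (Ici 0) t := by
  have hψ1 : ContDiff ℝ 1 ψ := hψ.of_le (by norm_num)
  have hψ' : ContDiff ℝ 1 (deriv ψ) := by
    have : ContDiff ℝ (1 + 1) ψ := by convert hψ using 1; norm_num
    exact (contDiff_succ_iff_deriv.1 this).2.2
  have h1 := (hu.deriv_ut t ht).inner ℝ (hasDerivAt_waveOdd hψ1 e t).hasDerivWithinAt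
  have h2 := (hu.deriv_u t ht).inner ℝ (hasDerivAt_waveOdd hψ' e t).hasDerivWithinAt
  refine (h1.fun_sub h2).congr_deriv ?_
  have h3 := inner_snd_waveEven (hu.mem t ht) hψ' e t
  have h4 := hu.inner_eq_trace he hh (contDiff_wave_profiles hψ1 e t).1 (by simp) ht
  rw [deriv_odd_profile hψ1, ← waveOdd_eq_cls hψ1.continuous,
    ← waveEven_eq_cls hψ'.continuous, h3] at h4
  have h5 : (ψ (t + (Real.pi - e)) - ψ (t + (e - Real.pi))) - (ψ (t + (0 - e)) - ψ (t + (e - 0)))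
      = ψ (t + Real.pi) - ψ (t - Real.pi) := by
    rcases he with rfl | rfl
    · simp [sub_eq_add_neg]
    · simp [sub_eq_add_neg]
  rw [h5] at h4
  rw [← h4]
  ring

/-- The values of the trace on `(0, T)`, tested against functions `ψ(· + π) - ψ(· - π)`, are
determined by the initial data. -/
theorem IsStrongSolution.integral_trace (hu : IsStrongSolution u ut uxx u₀ u₁)
    (he : e = 0 ∨ e = Real.pi) (hh : ∀ t, 0 ≤ t → HasTrace (u t).2 (Real.pi - e) (h t))
    {ψ : ℝ → ℝ} (hψ : ContDiff ℝ 2 ψ) {T : ℝ} (hT : 0 ≤ T)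
    (hzero : ∀ s, T - Real.pi < s → ψ s = 0) :
    ∫ t in (0)..T, h t * (ψ (t + Real.pi) - ψ (t - Real.pi))
      = - (inner ℝ u₁ (waveOdd ψ e 0) + inner ℝ u₀.2 (waveEven ψ e 0)) := by
  have hψ1 : ContDiff ℝ 1 ψ := hψ.of_le (by norm_num)
  have hψc := hψ1.continuous
  have hd := fun t (ht : 0 ≤ t) => hu.hasDerivWithinAt_pairing he hh hψ ht
  have heI : e ∈ Icc 0 Real.pi := by
    rcases he with rfl | rfl
    · exact left_mem_Icc.2 Real.pi_pos.le
    · exact right_mem_Icc.2 Real.pi_pos.le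
  have hint : IntervalIntegrable (fun t => h t * (ψ (t + Real.pi) - ψ (t - Real.pi)))
      volume 0 T := by
    apply ContinuousOn.intervalIntegrable
    rw [uIcc_of_le hT]
    refine ((hu.continuousOn_trace he hh).mono Icc_subset_Ici_self).mul ?_
    exact Continuous.continuousOn (by fun_prop)
  rw [intervalIntegral.integral_eq_sub_of_hasDeriv_right_of_le hT
    (f := fun s => inner ℝ (ut s) (waveOdd ψ e s) - inner ℝ (u s).1 (waveOdd (deriv ψ) e s))
    (fun t ht => ((hd t ht.1).continuousWithinAt).mono Icc_subset_Ici_self)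
    (fun t ht => (hd t ht.1.le).mono (fun s hs => (ht.1.trans hs).le)) hint]
  have hzero' : ∀ s, T - Real.pi < s → deriv ψ s = 0 := by
    intro s hs
    have : ψ =ᶠ[𝓝 s] fun _ => 0 := by
      filter_upwards [lt_mem_nhds hs] with r hr
      exact hzero r hr
    rw [this.deriv_eq]; simp
  have hu₀ : u₀ ∈ H10 := by
    have := hu.mem 0 le_rfl
    rwa [hu.init_u] at this
  simp only [waveOdd_eq_zero hψc heI hzero,
    waveOdd_eq_zero (hψ1.continuous_deriv le_rfl) heI hzero', inner_zero_right, hu.init_u,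
    hu.init_ut, inner_snd_waveEven hu₀ hψ1]
  ring

end Strong

theorem tendsto_integral_mul_of_tendsto_eLpNorm {ν : Measure ℝ} {h : ℕ → ℝ → ℝ} {g η : ℝ → ℝ}
    (hh : ∀ i, MemLp (h i) 2 ν) (hg : MemLp g 2 ν) (hη : MemLp η 2 ν)
    (hlim : Tendsto (fun i => eLpNorm (h i - g) 2 ν) atTop (𝓝 0)) :
    Tendsto (fun i => ∫ t, h i t * η t ∂ν) atTop (𝓝 (∫ t, g t * η t ∂ν)) := by
  have key : ∀ v (hv : MemLp v 2 ν), ∫ t, v t * η t ∂ν = inner ℝ (hv.toLp v) (hη.toLp η) := by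
    intro v hv
    rw [L2.inner_def]
    refine integral_congr_ae ?_
    filter_upwards [hv.coeFn_toLp, hη.coeFn_toLp] with t h1 h2
    rw [h1, h2]
    simp [mul_comm]
  simp only [key _ (hh _), key _ hg]
  have := (Lp.tendsto_Lp_iff_tendsto_eLpNorm'' h hh g hg).2 hlim
  exact this.inner tendsto_const_nhds

/-- The identity of `IsStrongSolution.integral_trace` persists for the trace in the sense of hidden
regularity, since both sides are continuous in the data. -/
theorem IsBoundaryDeriv.integral_eq {u₀ : L2 × L2} {u₁ : L2} {e : ℝ} {g : ℝ → ℝ}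
    (he : e = 0 ∨ e = Real.pi) (hg : IsBoundaryDeriv u₀ u₁ (Real.pi - e) g)
    {ψ : ℝ → ℝ} (hψ : ContDiff ℝ 2 ψ) {T : ℝ} (hT : 0 < T)
    (hzero : ∀ s, T - Real.pi < s → ψ s = 0) :
    ∫ t in Ioo 0 T, g t * (ψ (t + Real.pi) - ψ (t - Real.pi))
      = - (inner ℝ u₁ (waveOdd ψ e 0) + inner ℝ u₀.2 (waveEven ψ e 0)) := by
  obtain ⟨hmem, u₀s, u₁s, u, ut, uxx, h, hu, hh, hu₀, hu₁, hlim⟩ := hg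
  have hψc := hψ.continuous
  have hmemc : ∀ v : ℝ → ℝ, ContinuousOn v (Ici 0) → MemLp v 2 (volume.restrict (Ioo 0 T)) := by
    intro v hv
    have hv' : ContinuousOn v (Icc 0 T) := hv.mono Icc_subset_Ici_self
    obtain ⟨C, hC⟩ := isCompact_Icc.exists_bound_of_continuousOn hv'
    refine MemLp.of_bound ((hv'.mono Ioo_subset_Icc_self).aestronglyMeasurable measurableSet_Ioo)
      C ?_
    filter_upwards [ae_restrict_mem measurableSet_Ioo] with x hx
    exact hC x (Ioo_subset_Icc_self hx)
  have h1 := tendsto_integral_mul_of_tendsto_eLpNorm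
    (fun i => hmemc _ ((hu i).continuousOn_trace he (hh i))) (hmem T hT)
    (hmemc (fun t => ψ (t + Real.pi) - ψ (t - Real.pi)) (Continuous.continuousOn (by fun_prop)))
    (hlim T hT)
  have h2 : ∀ i, ∫ t in Ioo 0 T, h i t * (ψ (t + Real.pi) - ψ (t - Real.pi))
      = - (inner ℝ (u₁s i) (waveOdd ψ e 0) + inner ℝ (u₀s i).2 (waveEven ψ e 0)) := by
    intro i
    rw [← (hu i).integral_trace he (hh i) hψ hT.le hzero, intervalIntegral.integral_of_le hT.le,
      integral_Ioc_eq_integral_Ioo]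
  simp only [h2] at h1
  refine tendsto_nhds_unique h1 ?_
  refine ((hu₁.inner tendsto_const_nhds).add (Tendsto.inner ?_ tendsto_const_nhds)).neg
  exact (continuous_snd.tendsto u₀).comp hu₀

/-! ### The periodic profile of the data -/

/-- The `2π`-periodic profile `f` of the solution with data `(u₀, u₁)`, in terms of which
`u_x = f(t + x) + f(t - x)` and `u_t = f(t + x) - f(t - x)`. Hence `f = (u₀' + u₁) / 2` on `(0, π)`,
and `f(-x) = (u₀'(x) - u₁(x)) / 2` for `x` in `(0, π)`. The real number `s` is first reduced modulo
`2π` to a point of `[0, 2π)`. -/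
noncomputable def profile (u₀ : L2 × L2) (u₁ : L2) (s : ℝ) : ℝ :=
  if 2 * Real.pi * Int.fract (s / (2 * Real.pi)) < Real.pi then
    (u₀.2 (2 * Real.pi * Int.fract (s / (2 * Real.pi)))
      + u₁ (2 * Real.pi * Int.fract (s / (2 * Real.pi)))) / 2
  else
    (u₀.2 (2 * Real.pi - 2 * Real.pi * Int.fract (s / (2 * Real.pi)))
      - u₁ (2 * Real.pi - 2 * Real.pi * Int.fract (s / (2 * Real.pi)))) / 2

section Profile

variable (u₀ : L2 × L2) (u₁ : L2)

theorem profile_periodic : Function.Periodic (profile u₀ u₁) (2 * Real.pi) := by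
  intro s
  have : (s + 2 * Real.pi) / (2 * Real.pi) = s / (2 * Real.pi) + 1 := by
    field_simp
  simp only [profile, this, Int.fract_add_one]

theorem measurable_profile : Measurable (profile u₀ u₁) := by
  have hr : Measurable fun s : ℝ => 2 * Real.pi * Int.fract (s / (2 * Real.pi)) :=
    (measurable_fract.comp (measurable_id.div_const _)).const_mul _
  have h0 : Measurable u₀.2 := (Lp.stronglyMeasurable _).measurable
  have h1 : Measurable u₁ := (Lp.stronglyMeasurable _).measurable
  refine Measurable.ite (measurableSet_lt hr measurable_const) ?_ ?_
  · exact ((h0.comp hr).add (h1.comp hr)).div_const 2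
  · exact ((h0.comp (hr.const_sub _)).sub (h1.comp (hr.const_sub _))).div_const 2

theorem profile_of_mem {x : ℝ} (hx : x ∈ Ioo 0 Real.pi) :
    profile u₀ u₁ x = (u₀.2 x + u₁ x) / 2 := by
  have hpi := Real.pi_pos
  have hf : Int.fract (x / (2 * Real.pi)) = x / (2 * Real.pi) := by
    rw [Int.fract_eq_self]
    exact ⟨div_nonneg hx.1.le (by positivity), by
      rw [div_lt_one (by positivity)]; linarith [hx.2]⟩
  have hr : 2 * Real.pi * (x / (2 * Real.pi)) = x := by field_simp
  rw [profile, hf, hr, if_pos hx.2]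

theorem profile_neg_of_mem {x : ℝ} (hx : x ∈ Ioo 0 Real.pi) :
    profile u₀ u₁ (-x) = (u₀.2 x - u₁ x) / 2 := by
  have hpi := Real.pi_pos
  have hf : Int.fract (-x / (2 * Real.pi)) = 1 - x / (2 * Real.pi) := by
    rw [Int.fract_eq_iff]
    refine ⟨?_, ?_, -1, ?_⟩
    · rw [sub_nonneg, div_le_one (by positivity)]; linarith [hx.2]
    · have := div_pos hx.1 (by positivity : 0 < 2 * Real.pi)
      linarith
    · push_cast; ring
  have hr : 2 * Real.pi * (1 - x / (2 * Real.pi)) = 2 * Real.pi - x := by field_simp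
  rw [profile, hf, hr, if_neg (by linarith [hx.2]), sub_sub_cancel]

theorem memLp_profile : MemLp (profile u₀ u₁) 2 mu := by
  refine (memLp_congr_ae ?_).1 (Lp.memLp ((1 / 2 : ℝ) • (u₀.2 + u₁)))
  filter_upwards [Lp.coeFn_smul (1 / 2 : ℝ) (u₀.2 + u₁), Lp.coeFn_add u₀.2 u₁,
    ae_restrict_mem measurableSet_Ioo] with x h1 h2 hx
  rw [h1, profile_of_mem u₀ u₁ hx, Pi.smul_apply, h2, Pi.add_apply, smul_eq_mul]
  ring

theorem memLp_profile_neg : MemLp (fun x => profile u₀ u₁ (-x)) 2 mu := by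
  refine (memLp_congr_ae ?_).1 (Lp.memLp ((1 / 2 : ℝ) • (u₀.2 - u₁)))
  filter_upwards [Lp.coeFn_smul (1 / 2 : ℝ) (u₀.2 - u₁), Lp.coeFn_sub u₀.2 u₁,
    ae_restrict_mem measurableSet_Ioo] with x h1 h2 hx
  rw [h1, profile_neg_of_mem u₀ u₁ hx, Pi.smul_apply, h2, Pi.sub_apply, smul_eq_mul]
  ring

theorem intervalIntegrable_of_periodic {v : ℝ → ℝ} (hv : Function.Periodic v (2 * Real.pi))
    (h1 : IntegrableOn v (Ioo 0 Real.pi)) (h2 : IntegrableOn (fun x => v (-x)) (Ioo 0 Real.pi))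
    (a b : ℝ) : IntervalIntegrable v volume a b := by
  have hpi := Real.pi_pos
  refine hv.intervalIntegrable (t := -Real.pi) (by positivity) ?_ a b
  have e : -Real.pi + 2 * Real.pi = Real.pi := by ring
  rw [e]
  have i1 := intervalIntegrable_of_Ioo h1
  have i2 := (IntervalIntegrable.iff_comp_neg (by simp)).1 (intervalIntegrable_of_Ioo h2)
  simp only [neg_neg, neg_zero] at i2
  exact i2.symm.trans i1

theorem intervalIntegrable_profile (a b : ℝ) : IntervalIntegrable (profile u₀ u₁) volume a b :=
  intervalIntegrable_of_periodic (profile_periodic u₀ u₁)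
    ((memLp_profile u₀ u₁).integrable (by norm_num))
    ((memLp_profile_neg u₀ u₁).integrable (by norm_num)) a b

theorem intervalIntegrable_profile_sq (a b : ℝ) :
    IntervalIntegrable (fun s => profile u₀ u₁ s ^ 2) volume a b :=
  intervalIntegrable_of_periodic
    (fun s => by rw [profile_periodic u₀ u₁ s])
    (memLp_profile u₀ u₁).integrable_sq (memLp_profile_neg u₀ u₁).integrable_sq a b

theorem integral_neg_pi_pi {v : ℝ → ℝ} (hv : ∀ a b, IntervalIntegrable v volume a b) :
    ∫ s in (-Real.pi)..Real.pi, v s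
      = (∫ x in Ioo 0 Real.pi, v x) + ∫ x in Ioo 0 Real.pi, v (-x) := by
  rw [integral_Ioo_eq_intervalIntegral, integral_Ioo_eq_intervalIntegral,
    intervalIntegral.integral_comp_neg, neg_zero, add_comm,
    intervalIntegral.integral_add_adjacent_intervals (hv _ _) (hv _ _)]

/-- The energy is the squared `L²` norm of the profile over a period. -/
theorem energy_eq_integral_profile (a : ℝ) :
    energy u₀ u₁ = ∫ s in a..a + 2 * Real.pi, profile u₀ u₁ s ^ 2 := by
  have hper : Function.Periodic (fun s => profile u₀ u₁ s ^ 2) (2 * Real.pi) :=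
    fun s => by simp only [profile_periodic u₀ u₁ s]
  rw [hper.intervalIntegral_add_eq a (-Real.pi)]
  have e : -Real.pi + 2 * Real.pi = Real.pi := by ring
  rw [e, integral_neg_pi_pi (intervalIntegrable_profile_sq u₀ u₁),
    ← integral_add (memLp_profile u₀ u₁).integrable_sq (memLp_profile_neg u₀ u₁).integrable_sq,
    energy, ← integral_const_mul]
  refine setIntegral_congr_fun measurableSet_Ioo fun x hx => ?_
  simp only [profile_of_mem u₀ u₁ hx, profile_neg_of_mem u₀ u₁ hx, sq_abs]
  ring

theorem intervalIntegrable_profile_mul (c : ℝ) {v : ℝ → ℝ} (hv : Continuous v) (a b : ℝ) :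
    IntervalIntegrable (fun s => 2 * profile u₀ u₁ (s + c) * v s) volume a b := by
  have h1 := (intervalIntegrable_profile u₀ u₁ (a + c) (b + c)).comp_add_right c
  simp only [add_sub_cancel_right] at h1
  exact (h1.const_mul 2).mul_continuousOn hv.continuousOn

/-- The functional of the data in `IsBoundaryDeriv.integral_eq`, in terms of the profile. -/
theorem inner_wave_eq_integral_profile {e : ℝ} (he : e = 0 ∨ e = Real.pi) {ψ : ℝ → ℝ}
    (hψ : Continuous ψ) :
    inner ℝ u₁ (waveOdd ψ e 0) + inner ℝ u₀.2 (waveEven ψ e 0)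
      = ∫ s in (-Real.pi)..Real.pi, 2 * profile u₀ u₁ (s + e) * ψ s := by
  have c1 : Continuous fun x => ψ (x - e) := by fun_prop
  have c2 : Continuous fun x => ψ (e - x) := by fun_prop
  have h0 := L2.integrable u₀.2
  have h1 := L2.integrable u₁
  have hf : IntegrableOn (profile u₀ u₁) (Ioo 0 Real.pi) :=
    (memLp_profile u₀ u₁).integrable (by norm_num)
  have hfn : IntegrableOn (fun x => profile u₀ u₁ (-x)) (Ioo 0 Real.pi) :=
    (memLp_profile_neg u₀ u₁).integrable (by norm_num)
  have hi1 : Integrable (fun x => u₁ x * ψ (x - e) - u₁ x * ψ (e - x)) mu :=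
    (integrable_mul_of_continuous h1 c1).sub (integrable_mul_of_continuous h1 c2)
  have hi0 : Integrable (fun x => u₀.2 x * ψ (x - e) + u₀.2 x * ψ (e - x)) mu :=
    (integrable_mul_of_continuous h0 c1).add (integrable_mul_of_continuous h0 c2)
  have e1 : inner ℝ u₁ (waveOdd ψ e 0) + inner ℝ u₀.2 (waveEven ψ e 0)
      = (∫ x in Ioo 0 Real.pi, 2 * profile u₀ u₁ x * ψ (x - e))
        + ∫ x in Ioo 0 Real.pi, 2 * profile u₀ u₁ (-x) * ψ (e - x) := by
    rw [waveOdd, waveEven, inner_sub_right, inner_add_right]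
    simp only [zero_add]
    rw [inner_cls _ c1, inner_cls _ c1, inner_cls _ c2, inner_cls _ c2,
      ← integral_sub (integrable_mul_of_continuous h1 c1) (integrable_mul_of_continuous h1 c2),
      ← integral_add (integrable_mul_of_continuous h0 c1) (integrable_mul_of_continuous h0 c2),
      ← integral_add hi1 hi0,
      ← integral_add (integrable_mul_of_continuous (hf.const_mul 2) c1)
        (integrable_mul_of_continuous (hfn.const_mul 2) c2)]
    refine setIntegral_congr_fun measurableSet_Ioo fun x hx => ?_
    simp only [profile_of_mem u₀ u₁ hx, profile_neg_of_mem u₀ u₁ hx]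
    ring
  rw [e1]
  rcases he with rfl | rfl
  · have := integral_neg_pi_pi (intervalIntegrable_profile_mul u₀ u₁ 0 hψ)
    rw [this]
    simp
  · rw [integral_Ioo_eq_intervalIntegral, integral_Ioo_eq_intervalIntegral]
    have hI := intervalIntegrable_profile_mul u₀ u₁ Real.pi hψ
    rw [← intervalIntegral.integral_add_adjacent_intervals (hI (-Real.pi) 0) (hI 0 Real.pi)]
    congr 1
    · have := intervalIntegral.integral_comp_sub_right
        (fun s => 2 * profile u₀ u₁ (s + Real.pi) * ψ s) Real.pi (a := 0) (b := Real.pi)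
      simp only [sub_add_cancel, zero_sub, sub_self] at this
      exact this
    · have := intervalIntegral.integral_comp_sub_left
        (fun s => 2 * profile u₀ u₁ (s + Real.pi) * ψ s) Real.pi (a := 0) (b := Real.pi)
      simp only [sub_zero, sub_self] at this
      rw [← this]
      refine intervalIntegral.integral_congr fun x _ => ?_
      have e : Real.pi - x + Real.pi = -x + 2 * Real.pi := by ring
      simp only [e, profile_periodic u₀ u₁ (-x)]

end Profile

/-- The boundary trace at `π - e` is twice the translated profile. -/
theorem IsBoundaryDeriv.ae_eq_profile {u₀ : L2 × L2} {u₁ : L2} {e : ℝ} {g : ℝ → ℝ}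
    (he : e = 0 ∨ e = Real.pi) (hg : IsBoundaryDeriv u₀ u₁ (Real.pi - e) g)
    {T : ℝ} (hT : 0 < T) :
    ∀ᵐ t, t ∈ Ioo 0 T → g t = 2 * profile u₀ u₁ (t + (Real.pi - e)) := by
  have hpi := Real.pi_pos
  have hgi : IntegrableOn g (Ioo 0 T) := (hg.1 T hT).integrable (by norm_num)
  have hfi : IntegrableOn (fun t => 2 * profile u₀ u₁ (t + (Real.pi - e))) (Ioo 0 T) := by
    have := intervalIntegrable_profile_mul u₀ u₁ (Real.pi - e) (v := fun _ => 1)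
      continuous_const 0 T
    rw [intervalIntegrable_iff_integrableOn_Ioo_of_le hT.le] at this
    simpa using this
  have hvan : ∀ᵐ t, t ∈ Ioo 0 T → g t - 2 * profile u₀ u₁ (t + (Real.pi - e)) = 0 := by
    refine isOpen_Ioo.ae_eq_zero_of_integral_contDiff_smul_eq_zero
      (hgi.sub hfi).locallyIntegrableOn ?_
    intro η h1 _ h3
    have hη0 : ∀ s, s ∉ Ioo 0 T → η s = 0 := fun s hs =>
      image_eq_zero_of_notMem_tsupport fun h' => hs (h3 h')
    have hηc := h1.continuous
    obtain ⟨N, hN⟩ := exists_nat_ge (T / (2 * Real.pi))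
    rw [div_le_iff₀ (by positivity)] at hN
    -- The sum telescopes: `ψ(t + π) - ψ(t - π)` is `η(t)` up to a translate that vanishes.
    let ψ : ℝ → ℝ := fun s => - ∑ j ∈ Finset.range N, η (s + Real.pi + (j : ℝ) * (2 * Real.pi))
    have hψ : ContDiff ℝ 2 ψ := by
      refine (ContDiff.sum fun j _ => ?_).neg
      have h2 : ContDiff ℝ 2 η := by exact_mod_cast contDiff_infty.1 h1 2
      exact h2.comp (by fun_prop)
    have hψzero : ∀ s, T - Real.pi < s → ψ s = 0 := by
      intro s hs
      simp only [ψ, neg_eq_zero]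
      refine Finset.sum_eq_zero fun j _ => hη0 _ fun hm => ?_
      have : 0 ≤ (j : ℝ) * (2 * Real.pi) := by positivity
      linarith [hm.2]
    have hψη : ∀ t, t ∈ Ioo 0 T → ψ (t + Real.pi) - ψ (t - Real.pi) = η t := by
      intro t ht
      have h5 := Finset.sum_range_sub' (fun j : ℕ => η (t + (j : ℝ) * (2 * Real.pi))) N
      rw [Finset.sum_sub_distrib] at h5
      have h6 : η (t + (N : ℝ) * (2 * Real.pi)) = 0 := hη0 _ fun hm => by
        linarith [hm.2, ht.1]
      have h7 : ∀ j : ℕ, t + Real.pi + Real.pi + (j : ℝ) * (2 * Real.pi)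
          = t + ((j + 1 : ℕ) : ℝ) * (2 * Real.pi) := fun j => by push_cast; ring
      have h8 : ∀ j : ℕ, t - Real.pi + Real.pi + (j : ℝ) * (2 * Real.pi)
          = t + (j : ℝ) * (2 * Real.pi) := fun j => by ring
      simp only [ψ, h7, h8]
      simp only [Nat.cast_zero, zero_mul, add_zero, h6, sub_zero] at h5
      linarith
    have hmain := hg.integral_eq he hψ hT hψzero
    rw [inner_wave_eq_integral_profile u₀ u₁ he hψ.continuous] at hmain
    have hgη : ∫ t in Ioo 0 T, g t * (ψ (t + Real.pi) - ψ (t - Real.pi))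
        = ∫ t in Ioo 0 T, g t * η t :=
      setIntegral_congr_fun measurableSet_Ioo fun t ht => by simp only [hψη t ht]
    rw [hgη] at hmain
    set F : ℝ → ℝ := fun t => 2 * profile u₀ u₁ (t + (Real.pi - e)) * η t with hF
    have hFi := intervalIntegrable_profile_mul u₀ u₁ (Real.pi - e) hηc
    have hpiece : ∀ j : ℕ, ∫ s in (-Real.pi)..Real.pi,
        2 * profile u₀ u₁ (s + e) * η (s + Real.pi + (j : ℝ) * (2 * Real.pi))
        = ∫ t in ((j : ℕ) : ℝ) * (2 * Real.pi)..((j + 1 : ℕ) : ℝ) * (2 * Real.pi), F t := by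
      intro j
      have h5 := intervalIntegral.integral_comp_add_right F (Real.pi + (j : ℝ) * (2 * Real.pi))
        (a := -Real.pi) (b := Real.pi)
      have a1 : -Real.pi + (Real.pi + (j : ℝ) * (2 * Real.pi)) = (j : ℝ) * (2 * Real.pi) := by ring
      have a2 : Real.pi + (Real.pi + (j : ℝ) * (2 * Real.pi))
          = ((j + 1 : ℕ) : ℝ) * (2 * Real.pi) := by push_cast; ring
      rw [a1, a2] at h5
      rw [← h5]
      refine intervalIntegral.integral_congr fun s _ => ?_
      have hj := (profile_periodic u₀ u₁).nat_mul
      have : profile u₀ u₁ (s + (Real.pi + (j : ℝ) * (2 * Real.pi)) + (Real.pi - e))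
          = profile u₀ u₁ (s + e) := by
        rcases he with rfl | rfl
        · have a3 : s + (Real.pi + (j : ℝ) * (2 * Real.pi)) + (Real.pi - 0)
              = s + 0 + ((j + 1 : ℕ) : ℝ) * (2 * Real.pi) := by push_cast; ring
          rw [a3, hj (j + 1)]
        · have a3 : s + (Real.pi + (j : ℝ) * (2 * Real.pi)) + (Real.pi - Real.pi)
              = s + Real.pi + (j : ℝ) * (2 * Real.pi) := by ring
          rw [a3, hj j]
      simp only [hF]
      rw [this, add_assoc s Real.pi]
    have hsum : ∫ s in (-Real.pi)..Real.pi, 2 * profile u₀ u₁ (s + e) * ψ s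
        = - ∫ t in (0)..(N : ℝ) * (2 * Real.pi), F t := by
      have h5 : ∀ s, 2 * profile u₀ u₁ (s + e) * ψ s = - ∑ j ∈ Finset.range N,
          2 * profile u₀ u₁ (s + e) * η (s + Real.pi + (j : ℝ) * (2 * Real.pi)) := fun s => by
        simp only [ψ]
        rw [mul_neg, Finset.mul_sum]
      simp only [h5]
      rw [intervalIntegral.integral_neg, intervalIntegral.integral_finsetSum fun j _ =>
        intervalIntegrable_profile_mul u₀ u₁ e (by fun_prop) _ _]
      simp only [hpiece]
      have h6 := intervalIntegral.sum_integral_adjacent_intervals (f := F) (μ := volume)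
        (a := fun j : ℕ => (j : ℝ) * (2 * Real.pi)) (n := N) (fun j _ => hFi _ _)
      rw [h6]
      simp
    have hFT : ∫ t in (0)..(N : ℝ) * (2 * Real.pi), F t = ∫ t in Ioo 0 T, F t := by
      rw [← intervalIntegral.integral_add_adjacent_intervals (hFi 0 T) (hFi T _)]
      have h5 : ∫ t in T..(N : ℝ) * (2 * Real.pi), F t = 0 := by
        refine (intervalIntegral.integral_congr (g := fun _ => (0 : ℝ)) fun t ht => ?_).trans
          intervalIntegral.integral_zero
        rw [uIcc_of_le hN] at ht
        simp only [hF]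
        rw [hη0 t fun hm => absurd hm.2 (not_lt.2 ht.1), mul_zero]
      have h6 : ∫ t in (0)..T, F t = ∫ t in Ioo 0 T, F t := by
        rw [intervalIntegral.integral_of_le hT.le, integral_Ioc_eq_integral_Ioo]
      exact (congrArg₂ (· + ·) h6 h5).trans (add_zero _)
    rw [hsum, neg_neg, hFT] at hmain
    rw [← setIntegral_eq_integral_of_forall_compl_eq_zero (s := Ioo 0 T)
      fun t ht => by rw [hη0 t ht, zero_smul]]
    have hFon : IntegrableOn F (Ioo 0 T) :=
      (intervalIntegrable_iff_integrableOn_Ioo_of_le hT.le).1 (hFi 0 T)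
    have hgon : IntegrableOn (fun t => g t * η t) (Ioo 0 T) := by
      obtain ⟨C, hC⟩ := (isCompact_Icc (a := (0 : ℝ)) (b := T)).exists_bound_of_continuousOn
        hηc.continuousOn
      refine Integrable.mul_bdd (c := C) hgi hηc.aestronglyMeasurable ?_
      filter_upwards [ae_restrict_mem measurableSet_Ioo] with x hx
      exact hC x (Ioo_subset_Icc_self hx)
    have h9 := integral_sub hgon hFon
    rw [hmain, sub_self] at h9
    refine (integral_congr_ae (Eventually.of_forall fun t => ?_)).trans h9
    simp only [hF, smul_eq_mul]
    ring
  filter_upwards [hvan] with t ht htm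
  linarith [ht htm]

/-! ### Observability -/

/-- The observation at the arrival `y + q π` of the characteristic with phase `y + b π` sees the value
of a periodic function at that phase if `q - b` has the parity of the observation interval. -/
theorem periodic_apply_add_endpoint {G : ℝ → ENNReal}
    (hG : Function.Periodic G (2 * Real.pi)) {q j b : ℤ}
    (h : Even (q - j - b)) {l : ℕ} (hl : (l : ℤ) = j) (y : ℝ) :
    G (y + q * Real.pi + endpoint l) = G (y + b * Real.pi) := by
  obtain ⟨m, hm⟩ := h
  unfold endpoint
  split_ifs with hev
  · obtain ⟨i, hi⟩ := hev
    have : y + q * Real.pi + 0 = y + b * Real.pi + ((m + i : ℤ) : ℝ) * (2 * Real.pi) := by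
      have : (q : ℝ) = b + 2 * (m + i : ℤ) := by
        exact_mod_cast (by omega : q = b + 2 * (m + i : ℤ))
      rw [this]; ring
    rw [this, hG.int_mul]
  · obtain ⟨i, hi⟩ := Nat.not_even_iff_odd.1 hev
    have : y + q * Real.pi + Real.pi = y + b * Real.pi + ((m + i + 1 : ℤ) : ℝ) * (2 * Real.pi) := by
      have : (q : ℝ) = b + 2 * (m + i + 1 : ℤ) - 1 := by
        exact_mod_cast (by omega : q = b + 2 * (m + i + 1 : ℤ) - 1)
      rw [this]; ring
    rw [this, hG.int_mul]

/-- By the time `optTime`, half a period of a nonnegative density is controlled by its observed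
parts, each of which is used at most `passes + 1` times. -/
theorem lintegral_le_observed {k : ℕ} (hk : Even k) {T₀ : ℝ} (h : T₀ ∈ B k) {G : ℝ → ENNReal}
    (hGm : Measurable G) (hG : Function.Periodic G (2 * Real.pi)) {N : ℕ}
    (hN : optTime k T₀ ≤ N * T₀) (b : ℤ) :
    ∫⁻ y in Ioo (k * T₀ - Real.pi) (k * T₀), G (y + b * Real.pi)
      ≤ (passes k T₀ + 1) * ∑ j ∈ Finset.range N,
        ∫⁻ t in rateIntervals T₀ j ∩ Ioo 0 (optTime k T₀), G (t + endpoint j) := by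
  set S : ℕ → Set ℝ := fun j => rateIntervals T₀ j ∩ Ioo 0 (optTime k T₀) with hS
  have hSm : ∀ j, MeasurableSet (S j) := fun j => measurableSet_Ioo.inter measurableSet_Ioo
  have hmeas : ∀ j, Measurable ((S j).indicator fun t => G (t + endpoint j)) := fun j =>
    (hGm.comp (measurable_id.add_const _)).indicator (hSm j)
  have hmeas' : ∀ q j : ℕ, Measurable fun y : ℝ =>
      (S j).indicator (fun t => G (t + endpoint j)) (y + q * Real.pi) := fun q j =>
    (hmeas j).comp (measurable_id.add_const _)
  have hgen : ∀ᵐ y : ℝ, ∀ (q : ℕ) (n : ℤ), y + q * Real.pi ≠ n * T₀ := by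
    rw [ae_all_iff]; intro q
    rw [ae_all_iff]; intro n
    have : ∀ᵐ y : ℝ, y ≠ n * T₀ - q * Real.pi := by
      simp [ae_iff]
    filter_upwards [this] with y hy hy'
    exact hy (by linarith)
  calc ∫⁻ y in Ioo (k * T₀ - Real.pi) (k * T₀), G (y + b * Real.pi)
      ≤ ∫⁻ y in Ioo (k * T₀ - Real.pi) (k * T₀), ∑ q ∈ Finset.range (passes k T₀ + 1),
          ∑ j ∈ Finset.range N, (S j).indicator (fun t => G (t + endpoint j)) (y + q * Real.pi) := by
        refine lintegral_mono_ae ?_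
        filter_upwards [ae_restrict_of_ae hgen, ae_restrict_mem measurableSet_Ioo] with y hy hyI
        obtain ⟨q, hq, j, hj, hjT, hev⟩ := exists_observed hk h hyI hy b
        have hjN : j < N := by
          have : (j : ℝ) * T₀ < N * T₀ := hj.1.trans (hjT.2.trans_le hN)
          exact_mod_cast lt_of_mul_lt_mul_right this (B_pos h).le
        have e1 := periodic_apply_add_endpoint hG hev (l := j) rfl y
        push_cast at e1
        rw [← e1]
        have e2 : (S j).indicator (fun t => G (t + endpoint j)) (y + q * Real.pi)
            = G (y + q * Real.pi + endpoint j) := by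
          rw [indicator_of_mem]
          exact ⟨hj, hjT⟩
        rw [← e2]
        exact (Finset.single_le_sum (f := fun j => (S j).indicator (fun t => G (t + endpoint j))
            (y + q * Real.pi)) (fun _ _ => zero_le) (Finset.mem_range.2 hjN)).trans
          (Finset.single_le_sum (f := fun q : ℕ => ∑ j ∈ Finset.range N, (S j).indicator
            (fun t => G (t + endpoint j)) (y + q * Real.pi)) (fun _ _ => zero_le)
            (Finset.mem_range.2 (Nat.lt_succ_of_le hq)))
    _ ≤ ∫⁻ y, ∑ q ∈ Finset.range (passes k T₀ + 1),
          ∑ j ∈ Finset.range N, (S j).indicator (fun t => G (t + endpoint j)) (y + q * Real.pi) :=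
        setLIntegral_le_lintegral _ _
    _ = ∑ q ∈ Finset.range (passes k T₀ + 1), ∑ j ∈ Finset.range N,
          ∫⁻ t in S j, G (t + endpoint j) := by
        rw [lintegral_finsetSum _ fun q _ => Finset.measurable_fun_sum _ fun j _ => hmeas' q j]
        refine Finset.sum_congr rfl fun q _ => ?_
        rw [lintegral_finsetSum _ fun j _ => hmeas' q j]
        refine Finset.sum_congr rfl fun j _ => ?_
        rw [lintegral_add_right_eq_self ((S j).indicator fun t => G (t + endpoint j)),
          lintegral_indicator (hSm j)]
    _ = _ := by
        rw [Finset.sum_const, Finset.card_range, nsmul_eq_mul]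
        push_cast
        rfl

theorem observable_optTime {k : ℕ} (hk : Even k) {T₀ : ℝ} (h : T₀ ∈ B k) :
    Observable (rateIntervals T₀) (optTime k T₀) := by
  have hpi := Real.pi_pos
  have hT := optTime_pos h
  set T := optTime k T₀ with hTdef
  obtain ⟨n, hn⟩ := exists_nat_ge (T / T₀)
  rw [div_le_iff₀ (B_pos h)] at hn
  have hn' : T ≤ ((n + 1 : ℕ) : ℝ) * T₀ := by
    push_cast; nlinarith [B_pos h]
  have hP : (0 : ℝ) < passes k T₀ + 1 := by positivity
  -- Both halves of the period use each observed interval at most `passes + 1` times, and the observed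
  -- density is `4 f²`.
  refine ⟨hT, n, 2 / (passes k T₀ + 1), by positivity, ?_⟩
  intro u₀ u₁ _ u ut _ g hg0 hgpi
  set f := profile u₀ u₁ with hf
  set S : ℕ → Set ℝ := fun j => rateIntervals T₀ j ∩ Ioo 0 T with hS
  have hSm : ∀ j, MeasurableSet (S j) := fun j => measurableSet_Ioo.inter measurableSet_Ioo
  have hend : ∀ j, ∀ᵐ t, t ∈ Ioo 0 T → g (endpoint j) t = 2 * f (t + endpoint j) := by
    intro j
    unfold endpoint
    split_ifs
    · have := IsBoundaryDeriv.ae_eq_profile (e := Real.pi) (g := g 0) (Or.inr rfl)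
        (by simpa using hg0) hT
      simpa using this
    · have := IsBoundaryDeriv.ae_eq_profile (e := 0) (g := g Real.pi) (Or.inl rfl)
        (by simpa using hgpi) hT
      simpa using this
  have hsqi : ∀ (c a b : ℝ), a ≤ b → IntegrableOn (fun t => f (t + c) ^ 2) (Ioo a b) := by
    intro c a b hab
    have := (intervalIntegrable_profile_sq u₀ u₁ (a + c) (b + c)).comp_add_right c
    simp only [add_sub_cancel_right] at this
    exact (intervalIntegrable_iff_integrableOn_Ioo_of_le hab).1 this
  set A : ℕ → ℝ := fun j => ∫ t in S j, f (t + endpoint j) ^ 2 with hA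
  have hA0 : ∀ j, 0 ≤ A j := fun j => integral_nonneg fun t => sq_nonneg _
  have hobs : ∀ j, ∫ t in S j, |g (endpoint j) t| ^ 2 = 4 * A j := by
    intro j
    rw [hA, ← integral_const_mul]
    refine setIntegral_congr_ae (hSm j) ?_
    filter_upwards [hend j] with t ht htS
    rw [ht htS.2, sq_abs]
    ring
  have hG : Measurable fun s => ENNReal.ofReal (f s ^ 2) :=
    ((measurable_profile u₀ u₁).pow_const 2).ennreal_ofReal
  have hGp : Function.Periodic (fun s => ENNReal.ofReal (f s ^ 2)) (2 * Real.pi) :=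
    fun s => by simp only [hf, profile_periodic u₀ u₁ s]
  have hhalf : ∀ b : ℤ, ∫ y in Ioo (k * T₀ - Real.pi) (k * T₀), f (y + b * Real.pi) ^ 2
      ≤ (passes k T₀ + 1) * ∑ j ∈ Finset.range (n + 1), A j := by
    intro b
    have h1 := lintegral_le_observed hk h hG hGp hn' b
    rw [← ofReal_integral_eq_lintegral_ofReal (hsqi _ _ _ (by linarith))
      (Eventually.of_forall fun t => sq_nonneg _)] at h1
    have h2 : ∀ j, ∫⁻ t in S j, ENNReal.ofReal (f (t + endpoint j) ^ 2) = ENNReal.ofReal (A j) := by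
      intro j
      rw [hA, ofReal_integral_eq_lintegral_ofReal
        ((hsqi _ 0 T hT.le).mono_set inter_subset_right)
        (Eventually.of_forall fun t => sq_nonneg _)]
    simp only [← hTdef] at h1
    rw [Finset.sum_congr rfl fun j _ => h2 j, ← ENNReal.ofReal_sum_of_nonneg fun j _ => hA0 j] at h1
    have h3 : ((passes k T₀ : ENNReal) + 1) = ENNReal.ofReal (passes k T₀ + 1) := by
      rw [ENNReal.ofReal_add (by positivity) (by norm_num)]; simp
    rw [h3, ← ENNReal.ofReal_mul hP.le] at h1
    exact (ENNReal.ofReal_le_ofReal_iff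
      (mul_nonneg hP.le (Finset.sum_nonneg fun j _ => hA0 j))).1 h1
  have hE : energy u₀ u₁ = (∫ y in Ioo (k * T₀ - Real.pi) (k * T₀), f (y + (0 : ℤ) * Real.pi) ^ 2)
      + ∫ y in Ioo (k * T₀ - Real.pi) (k * T₀), f (y + (1 : ℤ) * Real.pi) ^ 2 := by
    have hsq := intervalIntegrable_profile_sq u₀ u₁
    rw [energy_eq_integral_profile u₀ u₁ (k * T₀ - Real.pi),
      ← intervalIntegral.integral_add_adjacent_intervals (hsq _ (k * T₀)) (hsq _ _)]
    have hle : k * T₀ - Real.pi ≤ k * T₀ := by linarith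
    rw [← integral_Ioc_eq_integral_Ioo, ← integral_Ioc_eq_integral_Ioo,
      ← intervalIntegral.integral_of_le hle, ← intervalIntegral.integral_of_le hle]
    have := intervalIntegral.integral_comp_add_right (fun s => f s ^ 2) Real.pi
      (a := k * T₀ - Real.pi) (b := k * T₀)
    have e1 : k * T₀ - Real.pi + Real.pi = k * T₀ := by ring
    have e2 : k * T₀ - Real.pi + 2 * Real.pi = k * T₀ + Real.pi := by ring
    rw [e1] at this
    simp only [Int.cast_zero, zero_mul, add_zero, Int.cast_one, one_mul, e2]
    rw [this]
  rw [Finset.sum_congr rfl fun j _ => hobs j, ← Finset.mul_sum, hE]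
  have h0 := hhalf 0
  have h1 := hhalf 1
  rw [div_mul_eq_mul_div, div_le_iff₀ hP]
  linarith

/-! ### Smooth functions in `H¹₀` -/

theorem IsTest.add {φ χ : ℝ → ℝ} (hφ : IsTest φ) (hχ : IsTest χ) : IsTest fun x => φ x + χ x :=
  ⟨hφ.1.add hχ.1, hφ.2.1.add hχ.2.1,
    (tsupport_add _ _).trans (union_subset hφ.2.2 hχ.2.2)⟩

theorem IsTest.const_mul {φ : ℝ → ℝ} (c : ℝ) (hφ : IsTest φ) : IsTest fun x => c * φ x :=
  ⟨contDiff_const.mul hφ.1, hφ.2.1.mul_left (f := fun _ => c),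
    (tsupport_mul_subset_right (f := fun _ => c)).trans hφ.2.2⟩

/-- The derivatives of test functions, as a subspace of `L²(0, π)`. -/
noncomputable def testDerivs : Submodule ℝ L2 where
  carrier := {p | ∃ φ, IsTest φ ∧ p = cls (deriv φ)}
  zero_mem' := by
    refine ⟨fun _ => 0, ⟨contDiff_const, HasCompactSupport.zero, by simp [tsupport]⟩, ?_⟩
    have := cls_const_mul (v := fun _ => (0 : ℝ)) 0 continuous_const
    simp only [zero_mul, zero_smul] at this
    simp [this]
  add_mem' := by
    rintro p q ⟨φ, hφ, rfl⟩ ⟨χ, hχ, rfl⟩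
    refine ⟨_, hφ.add hχ, ?_⟩
    rw [← cls_add hφ.continuous_deriv hχ.continuous_deriv]
    congr 1
    funext x
    exact (deriv_fun_add (hφ.contDiff_one.differentiable one_ne_zero x)
      (hχ.contDiff_one.differentiable one_ne_zero x)).symm
  smul_mem' := by
    rintro c p ⟨φ, hφ, rfl⟩
    refine ⟨_, hφ.const_mul c, ?_⟩
    rw [← cls_const_mul c hφ.continuous_deriv]
    congr 1
    funext x
    exact (deriv_const_mul c (hφ.contDiff_one.differentiable one_ne_zero x)).symm

/-- Functions of mean zero are limits of derivatives of test functions: by the lemma of du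
Bois-Reymond the orthogonal complement of the latter consists of constants. -/
theorem cls_mem_closure_testDerivs {q : ℝ → ℝ} (hq : Continuous q)
    (h0 : ∫ x in Ioo 0 Real.pi, q x = 0) : cls q ∈ testDerivs.topologicalClosure := by
  rw [← Submodule.orthogonal_orthogonal_eq_closure, Submodule.mem_orthogonal]
  intro w hw
  obtain ⟨c, hc⟩ := ae_eq_const_of_weak_deriv_zero (L2.integrable w) fun φ hφ => by
    rw [← inner_cls w hφ.continuous_deriv, real_inner_comm]
    exact (Submodule.mem_orthogonal _ _).1 hw _ ⟨φ, hφ, rfl⟩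
  rw [inner_cls w hq]
  calc ∫ x in Ioo 0 Real.pi, w x * q x = ∫ x in Ioo 0 Real.pi, c * q x := by
        refine integral_congr_ae ?_
        filter_upwards [hc] with x hx
        rw [hx]
    _ = 0 := by rw [integral_const_mul, h0, mul_zero]

theorem integral_abs_le {r : ℝ → ℝ} (hr : Continuous r) :
    ∫ x in Ioo 0 Real.pi, |r x| ≤ ‖cls r‖ * ‖cls fun _ => 1‖ := by
  have h1 := inner_cls (cls fun x => |r x|) (v := fun _ => 1) continuous_const
  have h2 : ∫ x in Ioo 0 Real.pi, cls (fun x => |r x|) x * 1 = ∫ x in Ioo 0 Real.pi, |r x| := by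
    refine integral_congr_ae ?_
    filter_upwards [cls_ae (v := fun x => |r x|) (by fun_prop)] with x hx
    rw [hx, mul_one]
  have h3 : ‖cls fun x => |r x|‖ ≤ ‖cls r‖ := by
    refine Lp.norm_le_norm_of_ae_le ?_
    filter_upwards [cls_ae (v := fun x => |r x|) (by fun_prop), cls_ae hr] with x h4 h5
    rw [h4, h5, Real.norm_eq_abs, abs_abs, Real.norm_eq_abs]
  rw [← h2, ← h1]
  exact (real_inner_le_norm _ _).trans (mul_le_mul_of_nonneg_right h3 (norm_nonneg _))

/-- The Poincaré inequality for functions that vanish at `0`. -/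
theorem norm_cls_le_of_apply_zero :
    ∃ C, 0 < C ∧ ∀ r : ℝ → ℝ, ContDiff ℝ 1 r → r 0 = 0 → ‖cls r‖ ≤ C * ‖cls (deriv r)‖ := by
  set K : ℝ := ((measureUnivNNReal mu ^ (2 : ENNReal).toReal⁻¹ : NNReal) : ℝ) with hK
  have hK0 : 0 ≤ K := NNReal.coe_nonneg _
  refine ⟨K * ‖cls fun _ => 1‖ + 1, by positivity, fun r hr h0 => ?_⟩
  have hr' := hr.continuous_deriv le_rfl
  have hM : 0 ≤ ‖cls (deriv r)‖ * ‖cls fun _ => 1‖ := by positivity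
  refine (norm_cls_le hr.continuous hM fun x hx => ?_).trans ?_
  · have h1 : ∫ y in (0)..x, deriv r y = r x - r 0 :=
      intervalIntegral.integral_deriv_eq_sub' r rfl
        (fun x _ => hr.differentiable one_ne_zero x) hr'.continuousOn
    rw [h0, sub_zero] at h1
    rw [← h1]
    have h2 := intervalIntegral.abs_integral_le_integral_abs (f := deriv r) (μ := volume) hx.1.le
    have habs : Continuous fun y => |deriv r y| := hr'.abs
    have h3 : ∫ y in (0)..x, |deriv r y| ≤ ∫ y in (0)..Real.pi, |deriv r y| :=
      intervalIntegral.integral_mono_interval le_rfl hx.1.le hx.2.le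
        (Eventually.of_forall fun y => abs_nonneg _) (habs.intervalIntegrable _ _)
    rw [← integral_Ioo_eq_intervalIntegral] at h3
    exact h2.trans (h3.trans (integral_abs_le hr'))
  · rw [← hK]
    have : 0 ≤ ‖cls (deriv r)‖ := norm_nonneg _
    nlinarith

/-- A `C¹` function that vanishes at both endpoints belongs to `H¹₀(0, π)`. -/
theorem cls_mem_H10 {v : ℝ → ℝ} (hv : ContDiff ℝ 1 v) (h0 : v 0 = 0) (hpi : v Real.pi = 0) :
    (cls v, cls (deriv v)) ∈ H10 := by
  have hv' := hv.continuous_deriv le_rfl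
  have hmean : ∫ x in Ioo 0 Real.pi, deriv v x = 0 := by
    rw [integral_Ioo_eq_intervalIntegral, intervalIntegral.integral_deriv_eq_sub' v rfl
      (fun x _ => hv.differentiable one_ne_zero x) hv'.continuousOn, h0, hpi, sub_zero]
  have hcl := cls_mem_closure_testDerivs hv' hmean
  rw [← SetLike.mem_coe, Submodule.topologicalClosure_coe, Metric.mem_closure_iff] at hcl
  obtain ⟨C, hC, hP⟩ := norm_cls_le_of_apply_zero
  refine Metric.mem_closure_iff.2 fun ε hε => ?_
  obtain ⟨_, ⟨φ, hφ, rfl⟩, hlt⟩ := hcl (min ε (ε / C)) (by positivity)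
  rw [dist_eq_norm] at hlt
  refine ⟨(cls φ, cls (deriv φ)), ⟨φ, hφ, cls_ae hφ.continuous, cls_ae hφ.continuous_deriv⟩, ?_⟩
  have hd : deriv (fun x => v x - φ x) = fun x => deriv v x - deriv φ x := by
    funext x
    exact deriv_fun_sub (hv.differentiable one_ne_zero x)
      (hφ.contDiff_one.differentiable one_ne_zero x)
  have h1 := hP (fun x => v x - φ x) (hv.sub hφ.contDiff_one) (by simp [h0, hφ.apply_zero])
  rw [hd, cls_sub hv.continuous hφ.continuous, cls_sub hv' hφ.continuous_deriv] at h1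
  rw [Prod.dist_eq, dist_eq_norm, dist_eq_norm]
  refine max_lt (h1.trans_lt ?_) (hlt.trans_le (min_le_left _ _))
  have := hlt.trans_le (min_le_right _ _)
  rw [lt_div_iff₀ hC] at this
  linarith

theorem hasWeakDeriv_cls {b : ℝ → ℝ} (hb : ContDiff ℝ 1 b) :
    HasWeakDeriv (cls b) (cls (deriv b)) := by
  intro φ hφ
  have := inner_snd_eq_of_mem_H10 hφ.mem_H10 hb
  rw [real_inner_comm, real_inner_comm _ (cls φ)] at this
  rwa [← inner_cls _ hφ.continuous_deriv, ← inner_cls _ hφ.continuous]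

/-! ### Smooth periodic solutions -/

theorem HasWeakDeriv.inner_eq_neg {p q : L2} (h : HasWeakDeriv p q) {w : L2 × L2} (hw : w ∈ H10) :
    inner ℝ q w.1 = - inner ℝ p w.2 := by
  have hclosed : IsClosed {w : L2 × L2 | inner ℝ q w.1 = - inner ℝ p w.2} :=
    isClosed_eq (by fun_prop) (by fun_prop)
  refine closure_minimal ?_ hclosed hw
  rintro w ⟨φ, hφ, h1, h2⟩
  change inner ℝ q w.1 = - inner ℝ p w.2
  rw [eq_cls hφ.continuous h1, eq_cls hφ.continuous_deriv h2, inner_cls _ hφ.continuous,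
    inner_cls _ hφ.continuous_deriv, h φ hφ, neg_neg]

theorem IsStrongSolution.isWeakSolution {u : ℝ → L2 × L2} {ut uxx : ℝ → L2} {u₀ : L2 × L2}
    {u₁ : L2} (hu : IsStrongSolution u ut uxx u₀ u₁) : IsWeakSolution u ut u₀ u₁ where
  mem := hu.mem
  cont := hu.cont
  deriv_u := hu.deriv_u
  cont_ut := fun t ht => (hu.deriv_ut t ht).continuousWithinAt
  weak_eq := by
    intro w hw t ht
    have := (hu.deriv_ut t ht).inner ℝ (hasDerivWithinAt_const t (Ici 0) w.1)
    simpa [(hu.weak_deriv t ht).inner_eq_neg hw] using this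
  init_u := hu.init_u
  init_ut := hu.init_ut

section Dalembert

variable {F : ℝ → ℝ}

theorem contDiff_deriv_of_smooth (hF : ContDiff ℝ ((⊤ : ℕ∞) : WithTop ℕ∞) F) :
    ContDiff ℝ ((⊤ : ℕ∞) : WithTop ℕ∞) (deriv F) :=
  (contDiff_infty_iff_deriv.1 hF).2

theorem deriv_periodic {c : ℝ} (hFp : Function.Periodic F c) :
    Function.Periodic (deriv F) c := by
  intro s
  rw [← deriv_comp_add_const]
  congr 1
  funext x
  exact hFp x

theorem waveOdd_mem_H10 (hF : ContDiff ℝ 1 F) (hFp : Function.Periodic F (2 * Real.pi)) (t : ℝ) :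
    (waveOdd F 0 t, waveEven (deriv F) 0 t) ∈ H10 := by
  rw [waveOdd_eq_cls hF.continuous, waveEven_eq_cls (hF.continuous_deriv le_rfl),
    ← deriv_odd_profile hF]
  refine cls_mem_H10 (contDiff_wave_profiles hF 0 t).1 (by simp) ?_
  have e : t + (Real.pi - 0) = t + (0 - Real.pi) + 2 * Real.pi := by ring
  rw [e, hFp, sub_self]

/-- The solution of d'Alembert, `u(x, t) = F(t + x) - F(t - x)`. -/
theorem isStrongSolution_dalembert (hF : ContDiff ℝ ((⊤ : ℕ∞) : WithTop ℕ∞) F)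
    (hFp : Function.Periodic F (2 * Real.pi)) :
    IsStrongSolution (fun t => (waveOdd F 0 t, waveEven (deriv F) 0 t)) (waveOdd (deriv F) 0)
      (waveOdd (deriv (deriv F)) 0) (waveOdd F 0 0, waveEven (deriv F) 0 0)
      (waveOdd (deriv F) 0 0) := by
  have one : ∀ {f : ℝ → ℝ}, ContDiff ℝ ((⊤ : ℕ∞) : WithTop ℕ∞) f → ContDiff ℝ 1 f := fun h =>
    h.of_le (by exact_mod_cast le_top)
  have hF' := contDiff_deriv_of_smooth hF
  have hF'' := contDiff_deriv_of_smooth hF'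
  have hcont : ∀ {f : ℝ → ℝ}, ContDiff ℝ 1 f → Continuous (waveOdd f 0) := fun h =>
    continuous_iff_continuousAt.2 fun t => (hasDerivAt_waveOdd h 0 t).continuousAt
  have hcont' : ∀ {f : ℝ → ℝ}, ContDiff ℝ 1 f → Continuous (waveEven f 0) := fun h =>
    continuous_iff_continuousAt.2 fun t => (hasDerivAt_waveEven h 0 t).continuousAt
  exact
  { mem := fun t _ => waveOdd_mem_H10 (one hF) hFp t
    weak_deriv := fun t _ => by
      have := hasWeakDeriv_cls (contDiff_wave_profiles (one hF') 0 t).2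
      rwa [deriv_even_profile (one hF'), ← waveEven_eq_cls hF'.continuous,
        ← waveOdd_eq_cls hF''.continuous] at this
    cont := ((hcont (one hF)).prodMk (hcont' (one hF'))).continuousOn
    cont_uxx := (hcont (one hF'')).continuousOn
    deriv_u := fun t _ => (hasDerivAt_waveOdd (one hF) 0 t).hasDerivWithinAt
    deriv_ut := fun t _ => (hasDerivAt_waveOdd (one hF') 0 t).hasDerivWithinAt
    init_u := rfl
    init_ut := rfl
    data_u₁ := ⟨_, waveOdd_mem_H10 (one hF') (deriv_periodic hFp) 0⟩ }

theorem isBoundaryDeriv_dalembert (hF : ContDiff ℝ ((⊤ : ℕ∞) : WithTop ℕ∞) F)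
    (hFp : Function.Periodic F (2 * Real.pi)) {y : ℝ} :
    IsBoundaryDeriv (waveOdd F 0 0, waveEven (deriv F) 0 0) (waveOdd (deriv F) 0 0) y
      (fun t => deriv F (t + y) + deriv F (t - y)) := by
  have hc : Continuous (deriv F) := (contDiff_deriv_of_smooth hF).continuous
  have hg : Continuous fun t => deriv F (t + y) + deriv F (t - y) := by fun_prop
  refine ⟨fun T _ => ?_, fun _ => _, fun _ => _, fun _ => _, fun _ => _, fun _ => _,
    fun _ t => deriv F (t + y) + deriv F (t - y), fun _ => isStrongSolution_dalembert hF hFp,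
    fun _ t _ => ?_, tendsto_const_nhds, tendsto_const_nhds, fun T _ => ?_⟩
  · obtain ⟨C, hC⟩ := (isCompact_Icc (a := (0 : ℝ)) (b := T)).exists_bound_of_continuousOn
      hg.continuousOn
    refine MemLp.of_bound hg.aestronglyMeasurable C ?_
    filter_upwards [ae_restrict_mem measurableSet_Ioo] with x hx
    exact hC x (Ioo_subset_Icc_self hx)
  · refine ⟨fun x => deriv F (t + (x - 0)) + deriv F (t + (0 - x)),
      Continuous.continuousOn (by fun_prop), ?_, ?_⟩
    · simp only [waveEven_eq_cls hc]
      exact cls_ae (by fun_prop)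
    · simp [sub_eq_add_neg]
  · simp

theorem energy_dalembert (hF : ContDiff ℝ ((⊤ : ℕ∞) : WithTop ℕ∞) F)
    (hFp : Function.Periodic F (2 * Real.pi)) (a : ℝ) :
    energy (waveOdd F 0 0, waveEven (deriv F) 0 0) (waveOdd (deriv F) 0 0)
      = ∫ s in a..a + 2 * Real.pi, deriv F s ^ 2 := by
  have hc : Continuous (deriv F) := (contDiff_deriv_of_smooth hF).continuous
  have hper : Function.Periodic (fun s => deriv F s ^ 2) (2 * Real.pi) :=
    fun s => by simp only [deriv_periodic hFp s]
  rw [hper.intervalIntegral_add_eq a (-Real.pi)]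
  have e : -Real.pi + 2 * Real.pi = Real.pi := by ring
  have hsq : Continuous fun s => deriv F s ^ 2 := by fun_prop
  have hi : ∀ {v : ℝ → ℝ}, Continuous v → Integrable v mu := fun hv =>
    (memLp_of_continuous hv).integrable (by norm_num)
  rw [e, integral_neg_pi_pi fun a b => hsq.intervalIntegrable a b,
    ← integral_add (hi hsq) (hi (v := fun x => deriv F (-x) ^ 2) (by fun_prop)),
    energy, ← integral_const_mul]
  refine integral_congr_ae ?_
  simp only [waveEven_eq_cls hc, waveOdd_eq_cls hc]
  filter_upwards [cls_ae (v := fun x => deriv F (0 + (x - 0)) + deriv F (0 + (0 - x)))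
      (by fun_prop), cls_ae (v := fun x => deriv F (0 + (x - 0)) - deriv F (0 + (0 - x)))
      (by fun_prop)] with x h1 h2
  rw [h1, h2, sq_abs, sq_abs]
  simp only [zero_add, sub_zero, zero_sub]
  ring

end Dalembert

/-! ### Failure of observability before the optimal time -/

/-- A smooth `2π`-periodic bump; for `0 < r ≤ π` it is positive exactly at the points whose
distance to `s₀` modulo `2π` is less than `r`. -/
noncomputable def bump (s₀ r s : ℝ) : ℝ := expNegInvGlue (Real.cos (s - s₀) - Real.cos r)

theorem contDiff_bump (s₀ r : ℝ) : ContDiff ℝ ((⊤ : ℕ∞) : WithTop ℕ∞) (bump s₀ r) :=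
  expNegInvGlue.contDiff.comp
    ((Real.contDiff_cos.comp (contDiff_id.sub contDiff_const)).sub contDiff_const)

theorem bump_periodic (s₀ r : ℝ) : Function.Periodic (bump s₀ r) (2 * Real.pi) := by
  intro s
  have : s + 2 * Real.pi - s₀ = s - s₀ + 2 * Real.pi := by ring
  simp only [bump, this, Real.cos_add_two_pi]

/-- Where the bump vanishes it is minimal, so that its derivative vanishes there too. -/
theorem deriv_bump_eq_zero {s₀ r s : ℝ} (h : Real.cos (s - s₀) ≤ Real.cos r) :
    deriv (bump s₀ r) s = 0 := by
  have h0 : bump s₀ r s = 0 := expNegInvGlue.zero_of_nonpos (by linarith)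
  have : IsLocalMin (bump s₀ r) s := Eventually.of_forall fun x => by
    rw [h0]; exact expNegInvGlue.nonneg _
  exact this.deriv_eq_zero

theorem exists_deriv_bump_ne_zero {s₀ r : ℝ} (hr : 0 < r) (hr' : r ≤ Real.pi) :
    ∃ s ∈ Icc s₀ (s₀ + 2 * Real.pi), deriv (bump s₀ r) s ≠ 0 := by
  have hpi := Real.pi_pos
  have hc := contDiff_bump s₀ r
  obtain ⟨c, hc1, hc2⟩ := exists_deriv_eq_slope (bump s₀ r) (a := s₀) (b := s₀ + Real.pi)
    (by linarith) hc.continuous.continuousOn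
    (hc.differentiable (by simp)).differentiableOn
  refine ⟨c, ⟨hc1.1.le, by linarith [hc1.2]⟩, ?_⟩
  have h1 : 0 < bump s₀ r s₀ := by
    apply expNegInvGlue.pos_of_pos
    rw [sub_self, Real.cos_zero, sub_pos, ← Real.cos_zero]
    exact Real.cos_lt_cos_of_nonneg_of_le_pi le_rfl hr' hr
  have h2 : bump s₀ r (s₀ + Real.pi) = 0 := by
    apply expNegInvGlue.zero_of_nonpos
    rw [add_sub_cancel_left, Real.cos_pi]
    linarith [Real.neg_one_le_cos r]
  rw [hc2, h2, zero_sub, add_sub_cancel_left]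
  exact (div_neg_of_neg_of_pos (by linarith) hpi).ne

theorem exists_int_abs_lt_of_cos_lt {d r : ℝ} (hr : 0 ≤ r) (h : Real.cos r < Real.cos d) :
    ∃ m : ℤ, |d - m * (2 * Real.pi)| < r := by
  have hpi := Real.pi_pos
  refine ⟨round (d / (2 * Real.pi)), ?_⟩
  by_contra! hle
  set x := d - round (d / (2 * Real.pi)) * (2 * Real.pi) with hx
  have h1 : |x| ≤ Real.pi := by
    have h2 := abs_sub_round (d / (2 * Real.pi))
    have h3 : x = (d / (2 * Real.pi) - round (d / (2 * Real.pi))) * (2 * Real.pi) := by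
      rw [hx]; field_simp
    rw [h3, abs_mul, abs_of_pos (by positivity : 0 < 2 * Real.pi)]
    nlinarith
  have h4 : Real.cos |x| = Real.cos d := by
    rw [Real.cos_abs, hx, Real.cos_sub_int_mul_two_pi]
  have := Real.cos_le_cos_of_nonneg_of_le_pi hr h1 hle
  linarith

theorem not_observable_of_lt {k : ℕ} (hk : Even k) {T₀ : ℝ} (h : T₀ ∈ B k) {T : ℝ}
    (hT : T < optTime k T₀) : ¬ Observable (rateIntervals T₀) T := by
  rintro ⟨_, n, c, hc, hobs⟩
  have hpi := Real.pi_pos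
  have hP := passes_sub_one_mul_drift_lt h
  -- The width of the set of phases that are still unobserved at time `T`.
  obtain ⟨ε, hε0, hε⟩ : ∃ ε, 0 < ε ∧ ε ≤ min (min ((T₀ - (passes k T₀ - 1) * drift k T₀) / 2)
      (optTime k T₀ - T)) Real.pi :=
    ⟨_, lt_min (lt_min (by linarith) (by linarith)) hpi, le_rfl⟩
  rw [le_min_iff, le_min_iff] at hε
  obtain ⟨⟨hε1, hε2⟩, hε3⟩ := hε
  set F := bump (k * T₀ - ε / 2) (ε / 2) with hF
  have hFs : ContDiff ℝ ((⊤ : ℕ∞) : WithTop ℕ∞) F := contDiff_bump _ _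
  have hFp : Function.Periodic F (2 * Real.pi) := bump_periodic _ _
  have hFp' := deriv_periodic hFp
  have hstrong := isStrongSolution_dalembert hFs hFp
  have key := hobs _ _ (waveOdd_mem_H10 (hFs.of_le (by exact_mod_cast le_top)) hFp 0) _ _
    hstrong.isWeakSolution (fun y t => deriv F (t + y) + deriv F (t - y))
    (isBoundaryDeriv_dalembert hFs hFp) (isBoundaryDeriv_dalembert hFs hFp)
  have hzero : ∀ j : ℕ, ∀ t ∈ rateIntervals T₀ j ∩ Ioo 0 T,
      deriv F (t + endpoint j) + deriv F (t - endpoint j) = 0 := by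
    rintro j t ⟨htj, ht0, htT⟩
    have hsame : deriv F (t - endpoint j) = deriv F (t + endpoint j) := by
      unfold endpoint
      split_ifs
      · simp
      · rw [← hFp' (t - Real.pi)]
        congr 1
        ring
    have h0 : deriv F (t + endpoint j) = 0 := by
      refine deriv_bump_eq_zero ?_
      by_contra! hlt
      obtain ⟨m, hm⟩ := exists_int_abs_lt_of_cos_lt (by positivity) hlt
      rw [abs_lt] at hm
      obtain ⟨q, hq, hqe⟩ : ∃ q : ℤ, Even (q - j) ∧
          t = t + endpoint j - m * (2 * Real.pi) + q * Real.pi := by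
        unfold endpoint
        split_ifs with hev
        · refine ⟨2 * m, ?_, by push_cast; ring⟩
          have : Even (j : ℤ) := by exact_mod_cast hev
          exact (even_two_mul m).sub this
        · refine ⟨2 * m - 1, ?_, by push_cast; ring⟩
          have : Odd (j : ℤ) := by exact_mod_cast Nat.not_even_iff_odd.1 hev
          exact ((even_two_mul m).sub_odd odd_one).sub_odd this
      have := not_observed_of_near hk h (ε := ε)
        (y := t + endpoint j - m * (2 * Real.pi)) (q := q) (j := j)
        (by linarith) ⟨by linarith [hm.1], by linarith [hm.2]⟩ hq (hqe ▸ htj) (hqe ▸ ht0)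
      rw [← hqe] at this
      linarith
    rw [hsame, h0, add_zero]
  have hsum : ∑ j ∈ Finset.range (n + 1), ∫ t in rateIntervals T₀ j ∩ Ioo 0 T,
      |deriv F (t + endpoint j) + deriv F (t - endpoint j)| ^ 2 = 0 := by
    refine Finset.sum_eq_zero fun j _ => ?_
    refine (setIntegral_congr_fun (g := fun _ => (0 : ℝ))
      (measurableSet_Ioo.inter measurableSet_Ioo) fun t ht => ?_).trans (by simp)
    simp [hzero j t ht]
  rw [hsum] at key
  obtain ⟨s, hs, hsne⟩ := exists_deriv_bump_ne_zero (s₀ := k * T₀ - ε / 2) (r := ε / 2)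
    (by positivity) (by linarith)
  have hF'c : Continuous (deriv F) := (contDiff_deriv_of_smooth hFs).continuous
  have hpos : 0 < energy (waveOdd F 0 0, waveEven (deriv F) 0 0) (waveOdd (deriv F) 0 0) := by
    rw [energy_dalembert hFs hFp (k * T₀ - ε / 2)]
    refine intervalIntegral.integral_pos (by linarith)
      (Continuous.continuousOn (by fun_prop)) (fun x _ => sq_nonneg _) ⟨s, hs, ?_⟩
    positivity
  nlinarith [mul_pos hc hpos]

theorem isOptimalTime_optTime {k : ℕ} (hk : Even k) {T₀ : ℝ} (h : T₀ ∈ B k) :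
    IsOptimalTime (rateIntervals T₀) (optTime k T₀) :=
  ⟨observable_optTime hk h, fun _ hT => not_observable_of_lt hk h hT⟩

end AlternatingWave

open AlternatingWave in
theorem proposition3p6 (k : ℕ) (hk : Even k) (hk0 : 0 < k) :
    (∀ T₀ ∈ B k, IsOptimalTime (rateIntervals T₀) (Topt T₀)) ∧
    {T₀ | T₀ ∈ B k ∧ ¬ ContinuousWithinAt Topt (B k) T₀} = {T₀ | ∃ m : ℕ, 1 ≤ m ∧ T₀ = xi k m} ∧
    ∀ m : ℕ, 1 ≤ m →
      Tendsto Topt (𝓝[<] (xi k m)) (𝓝 (Real.pi * (m + 3) + k * xi k m)) ∧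
      Tendsto Topt (𝓝[>] (xi k m)) (𝓝 (Real.pi * (m + 2) + k * xi k m)) ∧
      Function.leftLim Topt (xi k m) - Function.rightLim Topt (xi k m) = Real.pi :=
  discontinuities_of_formula fun _ h => isOptimalTime_optTime hk h
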